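/- Let $0<h_1<h_2<\pi$, $\delta,\theta\in\mathbb R\setminus\{0\}$, $D=[0,h_1)\cup(h_1,h_2)\cup(h_2,\pi]$. Let $q,\Delta:D\to\mathbb R$ be continuous with finite one-sided limits at $h_1$ and $h_2$, $\Delta\ge 0$, and $x-\Delta(x)\ge 0$ on $[0,h_1)$, $x-\Delta(x)\ge h_1$ on $(h_1,h_2)$, $x-\Delta(x)\ge h_2$ on $(h_2,\pi)$. Consider, with a real eigenparameter $\mu>0$, the problem $$y''(x)+q(x)\,y(x-\Delta(x))+\mu^2y(x)=0\quad(x\in D),$$ $$\mu y(0)+y'(0)=0,\qquad \mu^2y(\pi)+y'(\pi)=0,$$ $$y(h_1-0)=\delta y(h_1+0),\quad y'(h_1-0)=\delta y'(h_1+0),\quad y(h_2-0)=\theta y(h_2+0),\quad y'(h_2-0)=\theta y'(h_2+0)$$ (on $(h_1,h_2)$ and $(h_2,\pi]$, if $x-\Delta(x)$ equals the left endpoint $h_i$, then $y(x-\Delta(x))$ means $y(h_i+0)$). Assume (a) $q'$ and $\Delta''$ exist and are bounded on $D$ and have finite one-sided limits at $h_1$ and $h_2$; (b) $\Delta'\le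 1$ on $D$, and $\Delta(0)=\Delta(h_1+0)=\Delta(h_2+0)=0$. For $N\in\mathbb N$ put $$S_N(x)=\int_0^x q(\tau)\sin\!\big((N+\tfrac14)\Delta(\tau)\big)d\tau,\qquad C_N(x)=\int_0^x q(\tau)\cos\!\big((N+\tfrac14)\Delta(\tau)\big)d\tau,$$ $$F_N(x)=\cos\!\big((N+\tfrac14)x\big)\Big[1+\tfrac{S_N(x)-C_N(x)}{2N}+\tfrac{2x\,(2+C_N(\pi))}{\pi(4N+1)}\Big]-\sin\!\big((N+\tfrac14)x\big)\Big[1+\tfrac{S_N(x)+C_N(x)}{2N}-\tfrac{2x\,(2+C_N(\pi))}{\pi(4N+1)}\Big].$$ Then for all sufficiently large $N$ there is exactly one value $\mu_N>0$ with $|N+\frac14-\mu_N|<\frac14$ for which the problem has a nontrivial solution; such solutions do not vanish at $0$; and the eigenfunction $U_N$ for $\mu_N$ normalised by $U_N(0)=1$ satisfies, as $N\to\infty$ and uniformly in $x$, $$U_N(x)=\begin{cases}F_N(x)+O(1/N^2),&x\in[0,h_1),\\ \frac1\delta F_N(x)+O(1/N^2),&x\in(h_1,h_2),\\ \frac1{\delta\theta}F_N(x)+O(1/N^2),&x\in(h_2,\pi].\end{cases}$$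 -/

import Mathlib

open Set Filter Topology

noncomputable section

/-- The data of the boundary value problem
`y'' (x) + q (x) y (x - Δ x) + μ² y (x) = 0` on `[0,h₁) ∪ (h₁,h₂) ∪ (h₂,π]`
with transmission coefficients `δ` (at `h₁`) and `θ` (at `h₂`). -/
structure RetardedProblem where
  /-- potential -/
  q : ℝ → ℝ
  /-- retardation -/
  Δ : ℝ → ℝ
  /-- first point of discontinuity -/
  h₁ : ℝ
  /-- second point of discontinuity -/
  h₂ : ℝ
  /-- transmission coefficient at `h₁` -/
  δ : ℝ
  /-- transmission coefficient at `h₂` -/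
  θ : ℝ

/-- Three functions, the first one considered on `[0,h₁]`, the second one on `[h₁,h₂]` and the
third one on `[h₂,π]`. Together they describe a function on `[0,h₁) ∪ (h₁,h₂) ∪ (h₂,π]` that has
one-sided limits at `h₁` and `h₂`; those limits are the values of the pieces at the endpoints. -/
structure ThreePieces where
  /-- piece on `[0,h₁]` -/
  y₁ : ℝ → ℝ
  /-- piece on `[h₁,h₂]` -/
  y₂ : ℝ → ℝ
  /-- piece on `[h₂,π]` -/
  y₃ : ℝ → ℝ

/-- `f` has finite one-sided limits at `c` from both sides. -/
def HasOneSidedLimits (f : ℝ → ℝ) (c : ℝ) : Prop :=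
  (∃ l, Tendsto f (𝓝[<] c) (𝓝 l)) ∧ (∃ l, Tendsto f (𝓝[>] c) (𝓝 l))

namespace RetardedProblem

/-- The set `[0,h₁) ∪ (h₁,h₂) ∪ (h₂,π]`. -/
def dom (P : RetardedProblem) : Set ℝ :=
  Ico 0 P.h₁ ∪ Ioo P.h₁ P.h₂ ∪ Ioc P.h₂ Real.pi

/-- Standing assumptions on the data. -/
structure Standing (P : RetardedProblem) : Prop where
  h₁_pos : 0 < P.h₁
  h₁_lt_h₂ : P.h₁ < P.h₂
  h₂_lt_pi : P.h₂ < Real.pi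
  δ_ne : P.δ ≠ 0
  θ_ne : P.θ ≠ 0
  q_cont : ContinuousOn P.q P.dom
  q_lim₁ : HasOneSidedLimits P.q P.h₁
  q_lim₂ : HasOneSidedLimits P.q P.h₂
  Δ_nonneg : ∀ x ∈ P.dom, 0 ≤ P.Δ x
  Δ_cont : ContinuousOn P.Δ P.dom
  Δ_lim₁ : HasOneSidedLimits P.Δ P.h₁
  Δ_lim₂ : HasOneSidedLimits P.Δ P.h₂
  Δ_first : ∀ x ∈ Ico 0 P.h₁, 0 ≤ x - P.Δ x
  Δ_second : ∀ x ∈ Ioo P.h₁ P.h₂, P.h₁ ≤ x - P.Δ x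
  Δ_third : ∀ x ∈ Ioo P.h₂ Real.pi, P.h₂ ≤ x - P.Δ x

/-- Condition a: `q'` and `Δ''` exist and are bounded on `[0,h₁) ∪ (h₁,h₂) ∪ (h₂,π]`
(one-sided derivatives at `0` and `π`), and have finite one-sided limits at `h₁` and `h₂`. -/
structure CondA (P : RetardedProblem) : Prop where
  q_diff : DifferentiableOn ℝ P.q P.dom
  q_bdd : ∃ M, ∀ x ∈ P.dom, |derivWithin P.q P.dom x| ≤ M
  q_lim₁ : HasOneSidedLimits (derivWithin P.q P.dom) P.h₁
  q_lim₂ : HasOneSidedLimits (derivWithin P.q P.dom) P.h₂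
  Δ_diff : DifferentiableOn ℝ P.Δ P.dom
  Δ_diff₂ : DifferentiableOn ℝ (derivWithin P.Δ P.dom) P.dom
  Δ_bdd : ∃ M, ∀ x ∈ P.dom, |derivWithin (derivWithin P.Δ P.dom) P.dom x| ≤ M
  Δ_lim₁ : HasOneSidedLimits (derivWithin (derivWithin P.Δ P.dom) P.dom) P.h₁
  Δ_lim₂ : HasOneSidedLimits (derivWithin (derivWithin P.Δ P.dom) P.dom) P.h₂

/-- Condition b: `Δ' ≤ 1` and `Δ(0) = Δ(h₁+0) = Δ(h₂+0) = 0`. -/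
structure CondB (P : RetardedProblem) : Prop where
  deriv_le : ∀ x ∈ P.dom, derivWithin P.Δ P.dom x ≤ 1
  zero : P.Δ 0 = 0
  lim₁ : Tendsto P.Δ (𝓝[>] P.h₁) (𝓝 0)
  lim₂ : Tendsto P.Δ (𝓝[>] P.h₂) (𝓝 0)

/-- `y` is continuously differentiable on the closed interval `[a,b]` and satisfies
`y''(x) + q(x) y(x - Δ(x)) + μ² y(x) = 0` at every `x ∈ S` (where `S ⊆ [a,b]`);
derivatives at endpoints are one-sided. -/
def SolvesOn (P : RetardedProblem) (μ : ℝ) (y : ℝ → ℝ) (a b : ℝ) (S : Set ℝ) : Prop :=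
  DifferentiableOn ℝ y (Icc a b) ∧
  ContinuousOn (derivWithin y (Icc a b)) (Icc a b) ∧
  ∀ x ∈ S,
    DifferentiableWithinAt ℝ (derivWithin y (Icc a b)) (Icc a b) x ∧
    derivWithin (derivWithin y (Icc a b)) (Icc a b) x
      + P.q x * y (x - P.Δ x) + μ ^ 2 * y x = 0

/-- `U` solves the boundary value problem with parameter `μ`: the differential equation, the
two boundary conditions and the four transmission conditions. -/
structure IsSolution (P : RetardedProblem) (μ : ℝ) (U : ThreePieces) : Prop where
  eq₁ : P.SolvesOn μ U.y₁ 0 P.h₁ (Ico 0 P.h₁)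
  eq₂ : P.SolvesOn μ U.y₂ P.h₁ P.h₂ (Ioo P.h₁ P.h₂)
  eq₃ : P.SolvesOn μ U.y₃ P.h₂ Real.pi (Ioc P.h₂ Real.pi)
  bc_zero : μ * U.y₁ 0 + derivWithin U.y₁ (Icc 0 P.h₁) 0 = 0
  bc_pi : μ ^ 2 * U.y₃ Real.pi + derivWithin U.y₃ (Icc P.h₂ Real.pi) Real.pi = 0
  tc₁ : U.y₁ P.h₁ - P.δ * U.y₂ P.h₁ = 0
  tc₁' : derivWithin U.y₁ (Icc 0 P.h₁) P.h₁ - P.δ * derivWithin U.y₂ (Icc P.h₁ P.h₂) P.h₁ = 0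
  tc₂ : U.y₂ P.h₂ - P.θ * U.y₃ P.h₂ = 0
  tc₂' : derivWithin U.y₂ (Icc P.h₁ P.h₂) P.h₂
    - P.θ * derivWithin U.y₃ (Icc P.h₂ Real.pi) P.h₂ = 0

/-- An eigenfunction is a solution that is not identically zero on
`[0,h₁) ∪ (h₁,h₂) ∪ (h₂,π]`. -/
def IsEigenfunction (P : RetardedProblem) (μ : ℝ) (U : ThreePieces) : Prop :=
  P.IsSolution μ U ∧
  ((∃ x ∈ Ico 0 P.h₁, U.y₁ x ≠ 0) ∨ (∃ x ∈ Ioo P.h₁ P.h₂, U.y₂ x ≠ 0) ∨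
    (∃ x ∈ Ioc P.h₂ Real.pi, U.y₃ x ≠ 0))

/-- `μ` is a (positive) value of the eigenparameter for which an eigenfunction exists. -/
def IsEigenvalue (P : RetardedProblem) (μ : ℝ) : Prop :=
  0 < μ ∧ ∃ U, P.IsEigenfunction μ U

/-- `∫₀ˣ q(τ) sin((N + 1/4) Δ(τ)) dτ`. -/
def S (P : RetardedProblem) (N : ℕ) (x : ℝ) : ℝ :=
  ∫ τ in (0 : ℝ)..x, P.q τ * Real.sin (((N : ℝ) + 1 / 4) * P.Δ τ)

/-- `∫₀ˣ q(τ) cos((N + 1/4) Δ(τ)) dτ`. -/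
def C (P : RetardedProblem) (N : ℕ) (x : ℝ) : ℝ :=
  ∫ τ in (0 : ℝ)..x, P.q τ * Real.cos (((N : ℝ) + 1 / 4) * P.Δ τ)

/-- The leading terms and the `1/N` corrections of the eigenfunction, before the
scaling by `1`, `1/δ`, `1/(δθ)`. -/
def expansion (P : RetardedProblem) (N : ℕ) (x : ℝ) : ℝ :=
  Real.cos (((N : ℝ) + 1 / 4) * x) * (1 + 1 / (2 * (N : ℝ)) * (P.S N x - P.C N x))
  + Real.cos (((N : ℝ) + 1 / 4) * x)
      * (2 * x / (Real.pi * (4 * (N : ℝ) + 1)) * (2 + P.C N Real.pi))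
  - Real.sin (((N : ℝ) + 1 / 4) * x) * (1 + 1 / (2 * (N : ℝ)) * (P.S N x + P.C N x))
  + Real.sin (((N : ℝ) + 1 / 4) * x)
      * (2 * x / (Real.pi * (4 * (N : ℝ) + 1)) * (2 + P.C N Real.pi))

end RetardedProblem

end

/-! Multiply the second piece of a solution by `δ` and the third by `δθ`. The transmission
conditions then say exactly that the pieces join to a function w that is continuously differentiable
on [0, π]. Since the delayed argument d(x) = x - Δ(x) never leaves the piece containing x, the
rescaling respects the equation, and w'' + q w(d) + μ² w = 0 holds off the two jump points, with
w(0) = α and w'(0) = -μα. Variation of parameters turns this into the Volterra equation w(x) = α(cos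
μx - sin μx) - (1/μ) ∫₀ˣ q(τ) w(d(τ)) sin μ(x-τ) dτ. If |q| ≤ Q and μ ≥ 2Qπ, the integral operator
has norm at most 1/2, so for each α the solution is unique, and it exists for α = 1
(`DelayCoeffs.unique`, `DelayCoeffs.exists_solution`). In particular an eigenfunction cannot vanish
at 0.

For α = 1 the condition at π, divided by μ², reads cos μπ - sin μπ = R(μ), where both the size and
the Lipschitz constant of R are O(1/μ). With μ = N + 1/4 + ε the left side is ±√2 sin(επ), which is
steep near ε = 0; hence there is one root, and ε = O(1/N) (`eventually_existsUnique_root`).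

For the second term, insert the free solution cos - sin into the Volterra integral. Product-to-sum
formulas give phases μ(τ - d) = μΔ, which produce the integrals S and C, and phases μ(τ + d) = μ(2τ
- Δ). Because Δ' ≤ 1 the latter have derivative at least μ, so integration by parts makes their
contribution O(1/μ) (`abs_integral_mul_sin_le`). The characteristic equation then yields 2πε = -(2 +
C(π))/μ + O(1/N²) (`abs_shift_le`), and Taylor expansion of cos μx and sin μx about (N + 1/4)x gives
the claim (`DelayCoeffs.exists_refinedExpansion`). -/

noncomputable section

open MeasureTheory

/-! ### The delayed Volterra equation: regularity, a priori bounds, existence and uniqueness. -/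

/-- Coefficients `q` and deviated argument `d` of a retarded equation on `[0, π]`, continuous and
bounded off a small exceptional set `Z`. -/
structure DelayCoeffs (q d : ℝ → ℝ) (Z : Set ℝ) (Q : ℝ) : Prop where
  countable : Z.Countable
  closed : IsClosed Z
  nonneg : 0 ≤ Q
  q_cont : ContinuousOn q Zᶜ
  d_cont : ContinuousOn d Zᶜ
  q_le : ∀ τ ∈ Zᶜ, |q τ| ≤ Q
  d_mem : ∀ τ ∈ Zᶜ, d τ ∈ Icc 0 Real.pi

/-- The Volterra operator `∫₀ˣ q(τ) u(d(τ)) sin(μ(x-τ)+c) dτ`. -/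
def volterra (q d u : ℝ → ℝ) (μ c x : ℝ) : ℝ :=
  ∫ τ in (0 : ℝ)..x, q τ * u (d τ) * Real.sin (μ * (x - τ) + c)

/-- `u` satisfies on `[0, π]` the integral equation of the retarded initial value problem with
`u(0) = α`, `u'(0) = -μ α`. -/
def IsVolterra (q d : ℝ → ℝ) (μ α : ℝ) (u : ℝ → ℝ) : Prop :=
  Continuous u ∧ ∀ x ∈ Icc 0 Real.pi,
    u x = α * (Real.cos (μ * x) - Real.sin (μ * x)) - volterra q d u μ 0 x / μ

theorem ae_mem_compl_of_countable {Z : Set ℝ} (hZ : Z.Countable) : ∀ᵐ x : ℝ, x ∈ Zᶜ :=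
  hZ.ae_notMem volume

theorem intervalIntegrable_of_continuousOn_compl {Z : Set ℝ} (hZ : Z.Countable)
    (hc : IsClosed Z) {g : ℝ → ℝ} {B : ℝ} (hg : ContinuousOn g Zᶜ)
    (hB : ∀ x ∈ Zᶜ, |g x| ≤ B) (a b : ℝ) : IntervalIntegrable g volume a b := by
  have hm : AEStronglyMeasurable g volume := by
    have h1 := hg.aestronglyMeasurable (μ := volume) hc.isOpen_compl.measurableSet
    rwa [Measure.restrict_eq_self_of_ae_mem (ae_mem_compl_of_countable hZ)] at h1
  refine (intervalIntegrable_const (E := ℝ) (c := B)).mono_fun hm.restrict ?_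
  refine ae_restrict_of_ae ?_
  filter_upwards [ae_mem_compl_of_countable hZ] with x hx
  rw [Real.norm_eq_abs, Real.norm_eq_abs]
  exact (hB x hx).trans (le_abs_self B)

theorem abs_integral_le_pi {Z : Set ℝ} (hZ : Z.Countable) {g : ℝ → ℝ} {B x : ℝ}
    (hB0 : 0 ≤ B) (hx : x ∈ Icc 0 Real.pi) (hB : ∀ τ ∈ Zᶜ, τ ∈ Icc 0 x → |g τ| ≤ B) :
    |∫ τ in (0 : ℝ)..x, g τ| ≤ B * Real.pi := by
  have h1 : ‖∫ τ in (0 : ℝ)..x, g τ‖ ≤ B * |x - 0| := by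
    refine intervalIntegral.norm_integral_le_of_norm_le_const_ae ?_
    filter_upwards [ae_mem_compl_of_countable hZ] with τ hτ hτx
    rw [uIoc_of_le hx.1] at hτx
    exact hB τ hτ ⟨hτx.1.le, hτx.2⟩
  rw [sub_zero, abs_of_nonneg hx.1] at h1
  exact h1.trans (mul_le_mul_of_nonneg_left hx.2 hB0)

namespace DelayCoeffs

variable {q d : ℝ → ℝ} {Z : Set ℝ} {Q : ℝ}

theorem comp_cont (h : DelayCoeffs q d Z Q) {u : ℝ → ℝ} (hu : Continuous u) :
    ContinuousOn (fun τ => q τ * u (d τ)) Zᶜ :=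
  h.q_cont.mul (hu.comp_continuousOn h.d_cont)

theorem comp_le (h : DelayCoeffs q d Z Q) {u : ℝ → ℝ} {B : ℝ}
    (hu : ∀ x ∈ Icc 0 Real.pi, |u x| ≤ B) : ∀ τ ∈ Zᶜ, |q τ * u (d τ)| ≤ Q * B := by
  intro τ hτ
  rw [abs_mul]
  exact mul_le_mul (h.q_le τ hτ) (hu _ (h.d_mem τ hτ)) (abs_nonneg _) h.nonneg

theorem exists_bound {u : ℝ → ℝ} (hu : Continuous u) :
    ∃ B, 0 ≤ B ∧ ∀ x ∈ Icc 0 Real.pi, |u x| ≤ B := by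
  obtain ⟨B, hB⟩ := isCompact_Icc.exists_bound_of_continuousOn (s := Icc 0 Real.pi) hu.continuousOn
  exact ⟨B, (norm_nonneg _).trans (hB 0 ⟨le_rfl, Real.pi_pos.le⟩), hB⟩

/-- Integrability of the products `q · u(d) · s` with `s` continuous and bounded. -/
theorem integrable_mul (h : DelayCoeffs q d Z Q) {u s : ℝ → ℝ} (hu : Continuous u)
    (hs : Continuous s) (hs1 : ∀ x, |s x| ≤ 1) (a b : ℝ) :
    IntervalIntegrable (fun τ => q τ * u (d τ) * s τ) volume a b := by
  obtain ⟨B, hB0, hB⟩ := exists_bound hu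
  refine intervalIntegrable_of_continuousOn_compl h.countable h.closed (B := Q * B * 1)
    (g := fun τ => q τ * u (d τ) * s τ) ((h.comp_cont hu).mul hs.continuousOn) ?_ a b
  intro τ hτ
  rw [abs_mul]
  exact mul_le_mul (h.comp_le hB τ hτ) (hs1 τ) (abs_nonneg _) (mul_nonneg h.nonneg hB0)

theorem volterra_integrable (h : DelayCoeffs q d Z Q) {u : ℝ → ℝ} (hu : Continuous u)
    (μ c y a b : ℝ) :
    IntervalIntegrable (fun τ => q τ * u (d τ) * Real.sin (μ * (y - τ) + c)) volume a b :=
  h.integrable_mul hu (by fun_prop) (fun _ => Real.abs_sin_le_one _) a b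

theorem abs_volterra_le (h : DelayCoeffs q d Z Q) {u : ℝ → ℝ} {B : ℝ} (hB0 : 0 ≤ B)
    (hu : ∀ x ∈ Icc 0 Real.pi, |u x| ≤ B) (μ c : ℝ) {x : ℝ} (hx : x ∈ Icc 0 Real.pi) :
    |volterra q d u μ c x| ≤ Q * B * Real.pi := by
  refine abs_integral_le_pi h.countable (mul_nonneg h.nonneg hB0) hx ?_
  intro τ hτ _
  rw [abs_mul]
  exact (mul_le_mul (h.comp_le hu τ hτ) (Real.abs_sin_le_one _) (abs_nonneg _)
    (mul_nonneg h.nonneg hB0)).trans_eq (mul_one _)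

theorem volterra_sub (h : DelayCoeffs q d Z Q) {u v : ℝ → ℝ} (hu : Continuous u)
    (hv : Continuous v) (μ c x : ℝ) :
    volterra q d u μ c x - volterra q d v μ c x = volterra q d (fun t => u t - v t) μ c x := by
  unfold volterra
  rw [← intervalIntegral.integral_sub (h.volterra_integrable hu μ c x 0 x)
    (h.volterra_integrable hv μ c x 0 x)]
  congr 1
  ext τ
  ring

theorem volterra_congr (h : DelayCoeffs q d Z Q) {u v : ℝ → ℝ} (huv : EqOn u v (Icc 0 Real.pi))
    (μ c x : ℝ) : volterra q d u μ c x = volterra q d v μ c x := by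
  refine intervalIntegral.integral_congr_ae ?_
  filter_upwards [ae_mem_compl_of_countable h.countable] with τ hτ _
  rw [huv (h.d_mem τ hτ)]

/-- Separation of variables in the kernel. -/
theorem volterra_eq (h : DelayCoeffs q d Z Q) {u : ℝ → ℝ} (hu : Continuous u) (μ c x : ℝ) :
    volterra q d u μ c x =
      Real.sin (μ * x + c) * (∫ τ in (0 : ℝ)..x, q τ * u (d τ) * Real.cos (μ * τ))
      - Real.cos (μ * x + c) * ∫ τ in (0 : ℝ)..x, q τ * u (d τ) * Real.sin (μ * τ) := by
  have h1 := h.integrable_mul hu (s := fun τ => Real.cos (μ * τ)) (by fun_prop)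
    (fun _ => Real.abs_cos_le_one _) 0 x
  have h2 := h.integrable_mul hu (s := fun τ => Real.sin (μ * τ)) (by fun_prop)
    (fun _ => Real.abs_sin_le_one _) 0 x
  rw [← intervalIntegral.integral_const_mul, ← intervalIntegral.integral_const_mul,
    ← intervalIntegral.integral_sub (h1.const_mul _) (h2.const_mul _)]
  unfold volterra
  congr 1
  ext τ
  rw [show μ * (x - τ) + c = (μ * x + c) - μ * τ by ring, Real.sin_sub]
  ring

theorem continuous_primitive (h : DelayCoeffs q d Z Q) {u s : ℝ → ℝ} (hu : Continuous u)
    (hs : Continuous s) (hs1 : ∀ x, |s x| ≤ 1) :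
    Continuous fun x => ∫ τ in (0 : ℝ)..x, q τ * u (d τ) * s τ :=
  intervalIntegral.continuous_primitive (fun a b => h.integrable_mul hu hs hs1 a b) 0

theorem continuous_volterra (h : DelayCoeffs q d Z Q) {u : ℝ → ℝ} (hu : Continuous u)
    (μ c : ℝ) : Continuous (volterra q d u μ c) := by
  have h1 := h.continuous_primitive hu (s := fun τ => Real.cos (μ * τ)) (by fun_prop)
    (fun _ => Real.abs_cos_le_one _)
  have h2 := h.continuous_primitive hu (s := fun τ => Real.sin (μ * τ)) (by fun_prop)
    (fun _ => Real.abs_sin_le_one _)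
  have : volterra q d u μ c = _ := funext fun x => h.volterra_eq hu μ c x
  rw [this]
  fun_prop

theorem hasDerivAt_primitive (h : DelayCoeffs q d Z Q) {u s : ℝ → ℝ} (hu : Continuous u)
    (hs : Continuous s) (hs1 : ∀ x, |s x| ≤ 1) {x : ℝ} (hx : x ∈ Zᶜ) :
    HasDerivAt (fun x => ∫ τ in (0 : ℝ)..x, q τ * u (d τ) * s τ) (q x * u (d x) * s x) x := by
  have hc : ContinuousOn (fun τ => q τ * u (d τ) * s τ) Zᶜ := (h.comp_cont hu).mul hs.continuousOn
  have ho := h.closed.isOpen_compl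
  refine intervalIntegral.integral_hasDerivAt_right (h.integrable_mul hu hs hs1 0 x)
    (hc.stronglyMeasurableAtFilter ho x hx) (hc.continuousAt (ho.mem_nhds hx))

/-- Differentiating the kernel in `x` shifts its phase by π/2; the term with `sin c` is the value of
the integrand on the diagonal. Keeping `c` free lets one operator represent a solution and its
derivative. -/
theorem hasDerivAt_volterra (h : DelayCoeffs q d Z Q) {u : ℝ → ℝ} (hu : Continuous u)
    (μ c : ℝ) {x : ℝ} (hx : x ∈ Zᶜ) :
    HasDerivAt (volterra q d u μ c)
      (μ * volterra q d u μ (c + Real.pi / 2) x + q x * u (d x) * Real.sin c) x := by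
  have h1 := h.hasDerivAt_primitive hu (s := fun τ => Real.cos (μ * τ)) (by fun_prop)
    (fun _ => Real.abs_cos_le_one _) hx
  have h2 := h.hasDerivAt_primitive hu (s := fun τ => Real.sin (μ * τ)) (by fun_prop)
    (fun _ => Real.abs_sin_le_one _) hx
  have hl : HasDerivAt (fun y => μ * y + c) μ x := by
    simpa using ((hasDerivAt_id x).const_mul μ).add_const c
  have : volterra q d u μ c = _ := funext fun x => h.volterra_eq hu μ c x
  rw [this]
  convert! (hl.sin.mul h1).sub (hl.cos.mul h2) using 1
  rw [h.volterra_eq hu, ← add_assoc, Real.sin_add_pi_div_two, Real.cos_add_pi_div_two]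
  have : Real.sin c = Real.sin (μ * x + c - μ * x) := by ring_nf
  rw [this, Real.sin_sub]
  ring

/-- The kernel with `c = 0` vanishes on the diagonal, so that its Volterra integral is
differentiable everywhere. -/
theorem hasDerivAt_volterra_zero (h : DelayCoeffs q d Z Q) {u : ℝ → ℝ} (hu : Continuous u)
    (μ x : ℝ) :
    HasDerivAt (volterra q d u μ 0) (μ * volterra q d u μ (Real.pi / 2) x) x := by
  have hcont : Continuous fun x => μ * volterra q d u μ (Real.pi / 2) x :=
    continuous_const.mul (h.continuous_volterra hu _ _)
  -- The derivative formula off `Z` has a continuous right-hand side, so integrating it back removes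
  -- the exceptional set.
  have key : ∀ y, volterra q d u μ 0 y =
      ∫ t in (0 : ℝ)..y, μ * volterra q d u μ (Real.pi / 2) t := by
    intro y
    rw [integral_eq_of_hasDerivAt_off_countable (volterra q d u μ 0) _ h.countable
      (h.continuous_volterra hu μ 0).continuousOn ?_ (hcont.intervalIntegrable _ _)]
    · simp [volterra]
    · intro t ht
      simpa using h.hasDerivAt_volterra hu μ 0 ht.2
  rw [funext key]
  exact intervalIntegral.integral_hasDerivAt_right (hcont.intervalIntegrable _ _)
    (hcont.stronglyMeasurableAtFilter _ _) hcont.continuousAt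

/-- A solution of the Volterra equation is controlled by the inhomogeneity when `μ` is large. -/
theorem bound_of_le (h : DelayCoeffs q d Z Q) {μ A : ℝ} (hμ0 : 0 < μ)
    (hμ : 2 * Q * Real.pi ≤ μ) {w : ℝ → ℝ} (hw : Continuous w)
    (hA : ∀ x ∈ Icc 0 Real.pi, |w x| ≤ A + |volterra q d w μ 0 x| / μ) :
    ∀ x ∈ Icc 0 Real.pi, |w x| ≤ 2 * A := by
  -- At a maximum of |w| the Volterra term is at most half of that maximum and can be absorbed.
  obtain ⟨y, hy, hmax⟩ := isCompact_Icc.exists_isMaxOn (s := Icc 0 Real.pi)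
    ⟨0, le_rfl, Real.pi_pos.le⟩ hw.abs.continuousOn
  have hmax' : ∀ x ∈ Icc 0 Real.pi, |w x| ≤ |w y| := fun x hx => hmax hx
  have h1 := h.abs_volterra_le (abs_nonneg (w y)) hmax' μ 0 hy
  have h2 : |volterra q d w μ 0 y| / μ ≤ |w y| / 2 := by
    rw [div_le_iff₀ hμ0]
    nlinarith [abs_nonneg (w y), mul_le_mul_of_nonneg_left hμ (abs_nonneg (w y))]
  intro x hx
  linarith [hmax' x hx, hA y hy]

theorem abs_cos_sub_sin_le (t : ℝ) : |Real.cos t - Real.sin t| ≤ 2 :=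
  (abs_sub _ _).trans (by linarith [Real.abs_sin_le_one t, Real.abs_cos_le_one t])

/-- The difference of two solutions satisfies the homogeneous equation, so `bound_of_le` applies
with `A = 0`. -/
theorem unique (h : DelayCoeffs q d Z Q) {μ α : ℝ} (hμ0 : 0 < μ)
    (hμ : 2 * Q * Real.pi ≤ μ) {u v : ℝ → ℝ} (hu : IsVolterra q d μ α u)
    (hv : IsVolterra q d μ α v) : EqOn u v (Icc 0 Real.pi) := by
  intro x hx
  have := h.bound_of_le (A := 0) hμ0 hμ (hu.1.sub hv.1) (fun x hx => by
    rw [zero_add, ← abs_of_pos hμ0, ← abs_div, abs_of_pos hμ0]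
    simp only [Pi.sub_apply]
    rw [hu.2 x hx, hv.2 x hx]
    have := h.volterra_sub hu.1 hv.1 μ 0 x
    have e : (u - v) = fun t => u t - v t := rfl
    rw [e, ← this, ← abs_neg]
    apply le_of_eq
    congr 1
    ring) x hx
  simp only [Pi.sub_apply] at this
  have h0 : |u x - v x| = 0 := le_antisymm (by linarith) (abs_nonneg _)
  linarith [abs_eq_zero.1 h0]

theorem bound (h : DelayCoeffs q d Z Q) {μ : ℝ} (hμ0 : 0 < μ)
    (hμ : 2 * Q * Real.pi ≤ μ) {u : ℝ → ℝ} (hu : IsVolterra q d μ 1 u) :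
    ∀ x ∈ Icc 0 Real.pi, |u x| ≤ 4 := by
  have := h.bound_of_le (A := 2) hμ0 hμ hu.1 (fun x hx => by
    conv_lhs => rw [hu.2 x hx]
    refine (abs_sub _ _).trans (add_le_add ?_ ?_)
    · rw [one_mul]; exact abs_cos_sub_sin_le _
    · rw [abs_div, abs_of_pos hμ0])
  intro x hx
  linarith [this x hx]

/-- Banach's fixed point theorem on C[0, π]: the Lipschitz constant is Qπ/μ ≤ 1/2. Functions are
extended by constants beyond [0, π] so that `volterra` applies. -/
theorem exists_solution (h : DelayCoeffs q d Z Q) {μ : ℝ} (hμ0 : 0 < μ)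
    (hμ : 2 * Q * Real.pi ≤ μ) : ∃ u, IsVolterra q d μ 1 u := by
  let ext : C(Icc (0 : ℝ) Real.pi, ℝ) → ℝ → ℝ := fun φ => IccExtend Real.pi_pos.le φ
  have hext : ∀ φ, Continuous (ext φ) := fun φ => φ.continuous.Icc_extend'
  let T : C(Icc (0 : ℝ) Real.pi, ℝ) → C(Icc (0 : ℝ) Real.pi, ℝ) := fun φ =>
    ⟨fun x => 1 * (Real.cos (μ * x) - Real.sin (μ * x)) - volterra q d (ext φ) μ 0 x / μ, by
      have := h.continuous_volterra (hext φ) μ 0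
      fun_prop⟩
  have hT : ContractingWith (1 / 2) T := by
    refine ⟨by rw [← NNReal.coe_lt_coe]; norm_num, LipschitzWith.of_dist_le_mul fun φ ψ => ?_⟩
    refine (ContinuousMap.dist_le (mul_nonneg NNReal.zero_le_coe dist_nonneg)).2 ?_
    intro x
    have hb : ∀ y ∈ Icc 0 Real.pi, |ext φ y - ext ψ y| ≤ dist φ ψ := by
      intro y hy
      simp only [ext, IccExtend_of_mem _ _ hy]
      exact ContinuousMap.dist_apply_le_dist (f := φ) (g := ψ) ⟨y, hy⟩
    have h1 := h.abs_volterra_le (dist_nonneg : 0 ≤ dist φ ψ) hb μ 0 x.2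
    rw [← h.volterra_sub (hext φ) (hext ψ)] at h1
    have e : dist (T φ x) (T ψ x) =
        |volterra q d (ext φ) μ 0 x - volterra q d (ext ψ) μ 0 x| / μ := by
      rw [Real.dist_eq, ← abs_of_pos hμ0, ← abs_div, abs_of_pos hμ0, ← abs_neg]
      congr 1
      simp only [T, ContinuousMap.coe_mk]
      ring
    rw [e, div_le_iff₀ hμ0]
    have := mul_le_mul_of_nonneg_left hμ (dist_nonneg : 0 ≤ dist φ ψ)
    push_cast
    nlinarith
  obtain ⟨φ, hφ, -⟩ := hT.exists_fixedPoint 0 (edist_ne_top _ _)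
  refine ⟨ext φ, hext φ, fun x hx => ?_⟩
  have : φ ⟨x, hx⟩ = T φ ⟨x, hx⟩ := by rw [hφ]
  conv_lhs => simp only [ext, IccExtend_of_mem _ _ hx]
  exact this

end DelayCoeffs

/-! ### Dependence on the eigenparameter and the remainder of the characteristic equation. -/

theorem abs_div_sub_div_le {f g μ ν A B : ℝ} (hμ : 1 ≤ μ) (hν : 1 ≤ ν)
    (hfg : |f - g| ≤ A * |μ - ν|) (hg : |g| ≤ B) :
    |f / μ - g / ν| ≤ (A + B) * |μ - ν| / μ := by
  have hμ0 : 0 < μ := by linarith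
  have hν0 : 0 < ν := by linarith
  have e : f / μ - g / ν = ((f - g) + g * (ν - μ) / ν) / μ := by
    field_simp
    ring
  rw [e, abs_div, abs_of_pos hμ0]
  refine div_le_div_of_nonneg_right ?_ hμ0.le
  refine (abs_add_le _ _).trans ?_
  rw [add_mul]
  refine add_le_add hfg ?_
  rw [abs_div, abs_mul, abs_of_pos hν0, abs_sub_comm ν μ]
  refine (div_le_self (by positivity) hν).trans ?_
  exact mul_le_mul_of_nonneg_right hg (abs_nonneg _)

namespace DelayCoeffs

variable {q d : ℝ → ℝ} {Z : Set ℝ} {Q : ℝ}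

theorem abs_volterra_sub_le (h : DelayCoeffs q d Z Q) {v : ℝ → ℝ} (hv : Continuous v) {B : ℝ}
    (hB0 : 0 ≤ B) (hB : ∀ x ∈ Icc 0 Real.pi, |v x| ≤ B) (μ ν c : ℝ) {x : ℝ}
    (hx : x ∈ Icc 0 Real.pi) :
    |volterra q d v μ c x - volterra q d v ν c x| ≤ Q * B * Real.pi * Real.pi * |μ - ν| := by
  unfold volterra
  rw [← intervalIntegral.integral_sub (h.volterra_integrable hv μ c x 0 x)
    (h.volterra_integrable hv ν c x 0 x)]
  have hQB : 0 ≤ Q * B := mul_nonneg h.nonneg hB0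
  refine (abs_integral_le_pi h.countable (B := Q * B * (Real.pi * |μ - ν|))
    (mul_nonneg hQB (by positivity)) hx ?_).trans_eq (by ring)
  intro τ hτ hτx
  rw [← mul_sub, abs_mul]
  refine mul_le_mul (h.comp_le hB τ hτ) ?_ (abs_nonneg _) hQB
  refine (Real.abs_sin_sub_sin_le _ _).trans ?_
  rw [show μ * (x - τ) + c - (ν * (x - τ) + c) = (x - τ) * (μ - ν) by ring, abs_mul]
  refine mul_le_mul_of_nonneg_right ?_ (abs_nonneg _)
  rw [abs_of_nonneg (by linarith [hτx.2])]
  linarith [hτx.1, hx.2]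

/-- The difference of the solutions for μ and ν satisfies the equation for μ with an inhomogeneity
O(|μ - ν|), which `bound_of_le` doubles. -/
theorem lipschitz (h : DelayCoeffs q d Z Q) {μ ν : ℝ} (hμ1 : 1 ≤ μ) (hν1 : 1 ≤ ν)
    (hμ : 2 * Q * Real.pi ≤ μ) (hν : 2 * Q * Real.pi ≤ ν) {u v : ℝ → ℝ}
    (hu : IsVolterra q d μ 1 u) (hv : IsVolterra q d ν 1 v) :
    ∀ x ∈ Icc 0 Real.pi, |u x - v x| ≤ (8 * Real.pi + 4) * |μ - ν| := by
  have hμ0 : 0 < μ := by linarith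
  have hν0 : 0 < ν := by linarith
  have hπ := Real.pi_pos
  have hb := h.bound hν0 hν hv
  have key := h.bound_of_le (A := (4 * Real.pi + 2) * |μ - ν|) hμ0 hμ (hu.1.sub hv.1) (by
    intro x hx
    have e : (u - v) = fun t => u t - v t := rfl
    rw [e, ← h.volterra_sub hu.1 hv.1 μ 0 x]
    simp only
    rw [hu.2 x hx, hv.2 x hx]
    have h1 := h.abs_volterra_sub_le hv.1 (by norm_num) hb μ ν 0 hx
    have h2 := h.abs_volterra_le (by norm_num) hb ν 0 hx
    have h3 := abs_div_sub_div_le hμ1 hν1 h1 h2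
    have h3' : |volterra q d v μ 0 x / μ - volterra q d v ν 0 x / ν|
        ≤ (2 * Real.pi + 2) * |μ - ν| := by
      refine h3.trans ?_
      rw [div_le_iff₀ hμ0]
      have := mul_le_mul_of_nonneg_left hμ (show 0 ≤ (2 * Real.pi + 2) * |μ - ν| by positivity)
      nlinarith
    have hx' : |μ * x - ν * x| ≤ Real.pi * |μ - ν| := by
      rw [← sub_mul, abs_mul, abs_of_nonneg hx.1, mul_comm]
      exact mul_le_mul_of_nonneg_right hx.2 (abs_nonneg _)
    have h4 := (Real.abs_cos_sub_cos_le (μ * x) (ν * x)).trans hx'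
    have h5 := (Real.abs_sin_sub_sin_le (μ * x) (ν * x)).trans hx'
    have h6 : |(volterra q d u μ 0 x - volterra q d v μ 0 x) / μ|
        = |volterra q d u μ 0 x - volterra q d v μ 0 x| / μ := by
      rw [abs_div, abs_of_pos hμ0]
    rw [← h6]
    have e2 : 1 * (Real.cos (μ * x) - Real.sin (μ * x)) - volterra q d u μ 0 x / μ
        - (1 * (Real.cos (ν * x) - Real.sin (ν * x)) - volterra q d v ν 0 x / ν)
        = (Real.cos (μ * x) - Real.cos (ν * x)) - (Real.sin (μ * x) - Real.sin (ν * x))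
          - (volterra q d v μ 0 x / μ - volterra q d v ν 0 x / ν)
          - (volterra q d u μ 0 x - volterra q d v μ 0 x) / μ := by
      field_simp
      ring
    rw [e2]
    refine (abs_sub _ _).trans (add_le_add ?_ le_rfl)
    refine (abs_sub _ _).trans ?_
    have := abs_sub (Real.cos (μ * x) - Real.cos (ν * x)) (Real.sin (μ * x) - Real.sin (ν * x))
    linarith)
  intro x hx
  have := key x hx
  simp only [Pi.sub_apply] at this
  linarith

/-- The part of the normalised characteristic function that decays like `1/μ`. -/
def _root_.charRemainder (q d u : ℝ → ℝ) (μ : ℝ) : ℝ :=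
  volterra q d u μ 0 Real.pi / μ + (Real.sin (μ * Real.pi) + Real.cos (μ * Real.pi)) / μ
    + volterra q d u μ (Real.pi / 2) Real.pi / μ / μ

/-- Each of the two Volterra terms contributes 4Qπ, because |u| ≤ 4; the trigonometric term
contributes 2. -/
theorem abs_charRemainder_le (h : DelayCoeffs q d Z Q) {μ : ℝ} (hμ1 : 1 ≤ μ)
    (hμ : 2 * Q * Real.pi ≤ μ) {u : ℝ → ℝ} (hu : IsVolterra q d μ 1 u) :
    |charRemainder q d u μ| ≤ (8 * Q * Real.pi + 2) / μ := by
  have hμ0 : 0 < μ := by linarith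
  have hb := h.bound hμ0 hμ hu
  have hpi : Real.pi ∈ Icc 0 Real.pi := ⟨Real.pi_pos.le, le_rfl⟩
  have h1 := h.abs_volterra_le (by norm_num) hb μ 0 hpi
  have h2 := h.abs_volterra_le (by norm_num) hb μ (Real.pi / 2) hpi
  unfold charRemainder
  rw [← add_div, ← add_div, abs_div, abs_of_pos hμ0]
  refine div_le_div_of_nonneg_right ?_ hμ0.le
  have h3 : |volterra q d u μ (Real.pi / 2) Real.pi / μ| ≤ Q * 4 * Real.pi := by
    rw [abs_div, abs_of_pos hμ0]
    exact (div_le_self (abs_nonneg _) hμ1).trans h2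
  have h4 := abs_add_le (Real.sin (μ * Real.pi)) (Real.cos (μ * Real.pi))
  have h5 := abs_add_three (volterra q d u μ 0 Real.pi)
    (Real.sin (μ * Real.pi) + Real.cos (μ * Real.pi)) (volterra q d u μ (Real.pi / 2) Real.pi / μ)
  linarith [Real.abs_sin_le_one (μ * Real.pi), Real.abs_cos_le_one (μ * Real.pi)]

/-- This serves uniqueness of the root: the factor 1/μ makes the slope of the remainder eventually
smaller than that of the main term. -/
theorem exists_charRemainder_lipschitz (h : DelayCoeffs q d Z Q) :
    ∃ K, 0 ≤ K ∧ ∀ μ ν : ℝ, 1 ≤ μ → 1 ≤ ν → 2 * Q * Real.pi ≤ μ → 2 * Q * Real.pi ≤ ν →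
      ∀ u v, IsVolterra q d μ 1 u → IsVolterra q d ν 1 v →
      |charRemainder q d u μ - charRemainder q d v ν| ≤ K * |μ - ν| / μ := by
  have hπ := Real.pi_pos
  have hQ := h.nonneg
  obtain ⟨A, hA⟩ : ∃ A, A = Q * (8 * Real.pi + 4) * Real.pi + Q * 4 * Real.pi * Real.pi := ⟨_, rfl⟩
  obtain ⟨B, hB⟩ : ∃ B, B = Q * 4 * Real.pi := ⟨_, rfl⟩
  have hA0 : 0 ≤ A := by rw [hA]; positivity
  have hB0 : 0 ≤ B := by rw [hB]; positivity
  refine ⟨(A + B) + (2 * Real.pi + 2) + ((A + B) + B), by positivity, ?_⟩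
  intro μ ν hμ1 hν1 hμ hν u v hu hv
  have hμ0 : 0 < μ := by linarith
  have hν0 : 0 < ν := by linarith
  have hb := h.bound hν0 hν hv
  have hpi : Real.pi ∈ Icc 0 Real.pi := ⟨Real.pi_pos.le, le_rfl⟩
  have hE := h.lipschitz hμ1 hν1 hμ hν hu hv
  have hV : ∀ c, |volterra q d u μ c Real.pi - volterra q d v ν c Real.pi| ≤ A * |μ - ν| := by
    intro c
    have h1 := h.abs_volterra_sub_le hv.1 (by norm_num) hb μ ν c hpi
    have h2 := h.abs_volterra_le (by positivity) hE μ c hpi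
    rw [← h.volterra_sub hu.1 hv.1] at h2
    have h3 := abs_sub_le (volterra q d u μ c Real.pi) (volterra q d v μ c Real.pi)
      (volterra q d v ν c Real.pi)
    rw [hA]
    linarith
  have hW : ∀ c, |volterra q d v ν c Real.pi| ≤ B := fun c => by
    rw [hB]; exact h.abs_volterra_le (by norm_num) hb ν c hpi
  have h1 := abs_div_sub_div_le hμ1 hν1 (hV 0) (hW 0)
  have h2 := abs_div_sub_div_le hμ1 hν1 (hV (Real.pi / 2)) (hW (Real.pi / 2))
  have h2' : |volterra q d u μ (Real.pi / 2) Real.pi / μ - volterra q d v ν (Real.pi / 2) Real.pi / ν|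
      ≤ (A + B) * |μ - ν| := h2.trans (div_le_self (by positivity) hμ1)
  have h2'' : |volterra q d v ν (Real.pi / 2) Real.pi / ν| ≤ B := by
    rw [abs_div, abs_of_pos hν0]
    exact (div_le_self (abs_nonneg _) hν1).trans (hW _)
  have h3 := abs_div_sub_div_le hμ1 hν1 h2' h2''
  have hx' : |μ * Real.pi - ν * Real.pi| = Real.pi * |μ - ν| := by
    rw [← sub_mul, abs_mul, abs_of_pos hπ, mul_comm]
  have h4 := (Real.abs_sin_sub_sin_le (μ * Real.pi) (ν * Real.pi))
  have h5 := (Real.abs_cos_sub_cos_le (μ * Real.pi) (ν * Real.pi))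
  rw [hx'] at h4 h5
  have h6 : |(Real.sin (μ * Real.pi) + Real.cos (μ * Real.pi))
      - (Real.sin (ν * Real.pi) + Real.cos (ν * Real.pi))| ≤ (2 * Real.pi) * |μ - ν| := by
    rw [add_sub_add_comm]
    exact (abs_add_le _ _).trans (by linarith)
  have h7 : |Real.sin (ν * Real.pi) + Real.cos (ν * Real.pi)| ≤ 2 :=
    (abs_add_le _ _).trans
      (by linarith [Real.abs_sin_le_one (ν * Real.pi), Real.abs_cos_le_one (ν * Real.pi)])
  have h8 := abs_div_sub_div_le hμ1 hν1 h6 h7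
  unfold charRemainder
  rw [add_sub_add_comm, add_sub_add_comm]
  refine (abs_add_three _ _ _).trans ?_
  refine (add_le_add (add_le_add h1 h8) h3).trans_eq ?_
  ring

end DelayCoeffs

/-! ### Roots of the perturbed equation near N + 1/4. -/

theorem cos_sub_sin_eq (N : ℕ) (ε : ℝ) :
    Real.cos ((N + 1 / 4 + ε) * Real.pi) - Real.sin ((N + 1 / 4 + ε) * Real.pi) =
      -((-1) ^ N * (√2 * Real.sin (ε * Real.pi))) := by
  rw [show ((N : ℝ) + 1 / 4 + ε) * Real.pi = (ε * Real.pi + Real.pi / 4) + N * Real.pi by ring,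
    Real.cos_add_nat_mul_pi, Real.sin_add_nat_mul_pi, Real.cos_add, Real.sin_add,
    Real.cos_pi_div_four, Real.sin_pi_div_four]
  ring

theorem two_mul_abs_le_abs_sin {ε : ℝ} (hε : |ε| ≤ 1 / 2) :
    2 * |ε| ≤ |Real.sin (ε * Real.pi)| := by
  have hπ := Real.pi_pos
  have h := Real.mul_abs_le_abs_sin (x := ε * Real.pi) (by
    rw [abs_mul, abs_of_pos hπ]; nlinarith)
  refine le_trans (le_of_eq ?_) h
  rw [abs_mul, abs_of_pos hπ]
  field_simp

/-- In the sum-to-product formula the cosine is at least √2/2, since the half-sum of the angles is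
below π/4 in modulus, and the sine is at least |a - b| by Jordan's inequality. -/
theorem abs_sub_le_abs_sin_sub {a b : ℝ} (ha : |a| < 1 / 4) (hb : |b| < 1 / 4) :
    2 * |a - b| ≤ √2 * |Real.sin (a * Real.pi) - Real.sin (b * Real.pi)| := by
  have hπ := Real.pi_pos
  have ha' := abs_lt.1 ha
  have hb' := abs_lt.1 hb
  rw [Real.sin_sub_sin, abs_mul, abs_mul, abs_two]
  have h1 := two_mul_abs_le_abs_sin (ε := (a - b) / 2) (abs_le.2 ⟨by linarith, by linarith⟩)
  have h2 : √2 / 2 ≤ |Real.cos ((a * Real.pi + b * Real.pi) / 2)| := by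
    rw [← Real.cos_abs, ← Real.cos_pi_div_four]
    refine le_trans (Real.cos_le_cos_of_nonneg_of_le_pi (abs_nonneg _) (by linarith) ?_)
      (le_abs_self _)
    rw [abs_le]
    constructor <;> nlinarith
  rw [show (a * Real.pi - b * Real.pi) / 2 = (a - b) / 2 * Real.pi by ring]
  rw [abs_div, abs_two] at h1
  have h3 : √2 * √2 = 2 := Real.mul_self_sqrt (by norm_num)
  have h4 : |a - b| * (√2 / 2) ≤ |Real.sin ((a - b) / 2 * Real.pi)| *
      |Real.cos ((a * Real.pi + b * Real.pi) / 2)| :=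
    mul_le_mul (by linarith) h2 (by positivity) (abs_nonneg _)
  have h5 := mul_le_mul_of_nonneg_left h4 (show 0 ≤ 2 * √2 by positivity)
  nlinarith [abs_nonneg (a - b)]

/-- Roots of `cos(μπ) - sin(μπ) = R(μ)` for a remainder `R` of size and Lipschitz constant `O(1/μ)`:
there is exactly one root close to `N + 1/4`. -/
theorem eventually_existsUnique_root {R : ℝ → ℝ} {m M K : ℝ} (hM : 0 ≤ M) (hK : 0 ≤ K)
    (hR : ∀ μ, m ≤ μ → |R μ| ≤ M / μ)
    (hL : ∀ μ ν, m ≤ μ → m ≤ ν → |R μ - R ν| ≤ K * |μ - ν| / μ) :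
    ∀ᶠ N : ℕ in atTop,
      (∃! μ : ℝ, |(N : ℝ) + 1 / 4 - μ| < 1 / 4 ∧
        Real.cos (μ * Real.pi) - Real.sin (μ * Real.pi) = R μ) ∧
      ∀ μ : ℝ, |(N : ℝ) + 1 / 4 - μ| < 1 / 4 →
        Real.cos (μ * Real.pi) - Real.sin (μ * Real.pi) = R μ →
        |μ - ((N : ℝ) + 1 / 4)| ≤ M / N := by
  have hN := tendsto_natCast_atTop_atTop (R := ℝ)
  filter_upwards [hN.eventually_ge_atTop m, hN.eventually_ge_atTop 1,
    hN.eventually_ge_atTop (8 * M), hN.eventually_ge_atTop K] with N hm h1 h8 hNK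
  have hN0 : (0 : ℝ) < N := by linarith
  have hs2 : (1 : ℝ) ≤ √2 := by rw [Real.one_le_sqrt]; norm_num
  have hsign : |((-1 : ℝ)) ^ N| = 1 := by simp
  have hmem : ∀ μ : ℝ, |(N : ℝ) + 1 / 4 - μ| < 1 / 4 → (N : ℝ) ≤ μ := fun μ hμ => by
    have := abs_lt.1 hμ; linarith
  have hform : ∀ μ : ℝ, Real.cos (μ * Real.pi) - Real.sin (μ * Real.pi) =
      -((-1) ^ N * (√2 * Real.sin ((μ - (N + 1 / 4)) * Real.pi))) := fun μ => by
    rw [← cos_sub_sin_eq]; ring_nf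
  have hRN : ∀ μ : ℝ, (N : ℝ) ≤ μ → |R μ| ≤ M / N := fun μ hμ =>
    (hR μ (hm.trans hμ)).trans (div_le_div_of_nonneg_left hM hN0 hμ)
  have hcont : ContinuousOn R (Ici (N : ℝ)) := by
    refine (LipschitzOnWith.of_dist_le_mul (K := ⟨K, hK⟩) fun μ hμ ν hν => ?_).continuousOn
    have hμ1 : 1 ≤ μ := h1.trans hμ
    rw [Real.dist_eq, Real.dist_eq]
    exact (hL μ ν (hm.trans hμ) (hm.trans hν)).trans (div_le_self (by positivity) hμ1)
  have hM8 : M / N ≤ 1 / 8 := by rw [div_le_iff₀ hN0]; linarith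
  have hex : ∃ μ : ℝ, |(N : ℝ) + 1 / 4 - μ| < 1 / 4 ∧
      Real.cos (μ * Real.pi) - Real.sin (μ * Real.pi) = R μ := by
    -- Up to sign, `g` is the difference of the two sides. At N + 1/8 and N + 3/8 its main term is
    -- at most -1/4 and at least 1/4, while the remainder is at most 1/8 in modulus, so it changes
    -- sign.
    let g : ℝ → ℝ := fun μ => √2 * Real.sin ((μ - (N + 1 / 4)) * Real.pi) + (-1) ^ N * R μ
    have hg : ContinuousOn g (Icc ((N : ℝ) + 1 / 8) (N + 3 / 8)) := by
      have := hcont.mono (show Icc ((N : ℝ) + 1 / 8) (N + 3 / 8) ⊆ Ici (N : ℝ) from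
        fun x hx => by have := hx.1; simp only [mem_Ici]; linarith)
      fun_prop
    have hsin : 1 / 4 ≤ Real.sin (1 / 8 * Real.pi) := by
      have := two_mul_abs_le_abs_sin (ε := 1 / 8) (by rw [abs_of_pos] <;> norm_num)
      rw [abs_of_nonneg (Real.sin_nonneg_of_nonneg_of_le_pi (by positivity)
        (by linarith [Real.pi_pos])), abs_of_pos (by norm_num)] at this
      linarith
    have hs : 1 / 4 ≤ √2 * Real.sin (1 / 8 * Real.pi) := by nlinarith
    have habs : ∀ μ, (N : ℝ) ≤ μ → |(-1) ^ N * R μ| ≤ 1 / 8 := fun μ hμ => by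
      rw [abs_mul, hsign, one_mul]; exact (hRN μ hμ).trans hM8
    have h0 : (0 : ℝ) ∈ Icc (g (N + 1 / 8)) (g (N + 3 / 8)) := by
      have e1 : ((N : ℝ) + 1 / 8 - (N + 1 / 4)) * Real.pi = -(1 / 8 * Real.pi) := by ring
      have e2 : ((N : ℝ) + 3 / 8 - (N + 1 / 4)) * Real.pi = (1 / 8 * Real.pi) := by ring
      have a1 := abs_le.1 (habs (N + 1 / 8) (by linarith))
      have a2 := abs_le.1 (habs (N + 3 / 8) (by linarith))
      simp only [g, e1, e2, Real.sin_neg]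
      constructor <;> linarith
    obtain ⟨μ, hμ, hμ0⟩ := intermediate_value_Icc (by linarith) hg h0
    refine ⟨μ, abs_lt.2 ⟨by linarith [hμ.2], by linarith [hμ.1]⟩, ?_⟩
    rw [hform]
    simp only [g] at hμ0
    have hsq : ((-1 : ℝ)) ^ N * (-1) ^ N = 1 := by rw [← mul_pow]; simp
    linear_combination (-(-1) ^ N) * hμ0 + R μ * hsq
  constructor
  · obtain ⟨μ, hμ⟩ := hex
    refine ⟨μ, hμ, ?_⟩
    rintro ν ⟨hν1, hν2⟩
    obtain ⟨hμ1, hμ2⟩ := hμ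
    have hμN := hmem μ hμ1
    have hνN := hmem ν hν1
    have a1 := abs_sub_le_abs_sin_sub (a := μ - (N + 1 / 4)) (b := ν - (N + 1 / 4))
      (by rwa [abs_sub_comm]) (by rwa [abs_sub_comm])
    rw [show μ - (N + 1 / 4) - (ν - (N + 1 / 4)) = μ - ν by ring] at a1
    have a2 := hL μ ν (hm.trans hμN) (hm.trans hνN)
    rw [← hμ2, ← hν2, hform, hform, show ∀ a b : ℝ, -((-1) ^ N * (√2 * a)) - -((-1) ^ N * (√2 * b))
      = (-1) ^ N * (√2 * (b - a)) from fun a b => by ring, abs_mul, hsign, one_mul, abs_mul,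
      abs_of_pos (by linarith : 0 < √2), abs_sub_comm] at a2
    -- As K ≤ N ≤ μ, two roots satisfy 2|μ - ν| ≤ |R μ - R ν| ≤ |μ - ν|, hence coincide.
    have a3 : K * |μ - ν| / μ ≤ |μ - ν| := by
      rw [div_le_iff₀ (by linarith)]
      nlinarith [abs_nonneg (μ - ν)]
    have : |μ - ν| = 0 := le_antisymm (by linarith) (abs_nonneg _)
    linarith [abs_eq_zero.1 this]
  · intro μ hμ1 hμ2
    have hμN := hmem μ hμ1
    have a1 := two_mul_abs_le_abs_sin (ε := μ - (N + 1 / 4))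
      (by rw [abs_sub_comm]; linarith)
    have a2 := hRN μ hμN
    rw [← hμ2, hform, abs_neg, abs_mul, hsign, one_mul, abs_mul,
      abs_of_pos (by linarith : 0 < √2)] at a2
    nlinarith [abs_nonneg (μ - (N + 1 / 4)), abs_nonneg (Real.sin ((μ - (N + 1 / 4)) * Real.pi))]

/-! ### Two-term asymptotics of the solution and of the root. -/

/-- `∫₀ˣ q(τ) cos(μ(τ - d(τ))) dτ`. -/
def delayCos (q d : ℝ → ℝ) (μ x : ℝ) : ℝ := ∫ τ in (0 : ℝ)..x, q τ * Real.cos (μ * (τ - d τ))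

/-- `∫₀ˣ q(τ) sin(μ(τ - d(τ))) dτ`. -/
def delaySin (q d : ℝ → ℝ) (μ x : ℝ) : ℝ := ∫ τ in (0 : ℝ)..x, q τ * Real.sin (μ * (τ - d τ))

/-- The integrals of `q` against oscillations of phase `μ(τ + d(τ))` are `O(1/μ)`. -/
def Oscillates (q d : ℝ → ℝ) (J : ℝ) : Prop :=
  ∀ μ c : ℝ, 0 < μ → ∀ x ∈ Icc 0 Real.pi,
    |∫ τ in (0 : ℝ)..x, q τ * Real.sin (μ * (τ + d τ) + c)| ≤ J / μ

/-- Two-term expansion of the normalised solution in terms of `ν = N + 1/4`. -/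
def refinedExpansion (q d : ℝ → ℝ) (N ν x : ℝ) : ℝ :=
  Real.cos (ν * x) * (1 + (delaySin q d ν x - delayCos q d ν x) / 2 / N)
  - Real.sin (ν * x) * (1 + (delaySin q d ν x + delayCos q d ν x) / 2 / N)
  + (2 + delayCos q d ν Real.pi) / ν / (2 * Real.pi) * x * (Real.cos (ν * x) + Real.sin (ν * x))

theorem abs_cos_add_sub_le (a h : ℝ) :
    |Real.cos (a + h) - Real.cos a + h * Real.sin a| ≤ 2 * h ^ 2 := by
  have h1 : |Real.cos h - 1| ≤ h ^ 2 := by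
    rw [abs_le]
    constructor
    · nlinarith [Real.one_sub_sq_div_two_le_cos (x := h), sq_nonneg h]
    · nlinarith [Real.cos_le_one h, sq_nonneg h]
  have h2 : |Real.sin h - h| ≤ h ^ 2 := by
    -- The crude quadratic bound must hold for every y: the cubic estimate serves y ≤ 1, positivity
    -- of sine serves y ≤ 2, and beyond that y + 1 ≤ y².
    have key : ∀ y : ℝ, 0 ≤ y → |Real.sin y - y| ≤ y ^ 2 := by
      intro y hy
      have hle := Real.sin_le hy
      rw [abs_sub_comm, abs_of_nonneg (by linarith)]
      rcases hy.eq_or_lt with rfl | hy0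
      · simp
      rcases le_or_gt y 1 with h1 | h1
      · have := Real.sin_gt_sub_cube hy0
        nlinarith [pow_pos hy0 2, pow_pos hy0 3]
      · rcases le_or_gt y 2 with h2 | h2
        · have : 0 ≤ Real.sin y := Real.sin_nonneg_of_nonneg_of_le_pi hy
            (by linarith [Real.pi_gt_three])
          nlinarith
        · nlinarith [Real.neg_one_le_sin y]
    rcases le_total 0 h with h0 | h0
    · exact key h h0
    · have := key (-h) (by linarith)
      rw [Real.sin_neg, neg_sq, ← abs_neg] at this
      convert this using 2
      ring
  have e : Real.cos (a + h) - Real.cos a + h * Real.sin a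
      = Real.cos a * (Real.cos h - 1) - Real.sin a * (Real.sin h - h) := by
    rw [Real.cos_add]; ring
  rw [e]
  refine (abs_sub _ _).trans ?_
  rw [abs_mul, abs_mul]
  have := mul_le_mul (Real.abs_cos_le_one a) h1 (abs_nonneg _) zero_le_one
  have := mul_le_mul (Real.abs_sin_le_one a) h2 (abs_nonneg _) zero_le_one
  linarith

theorem abs_sin_add_sub_le (a h : ℝ) :
    |Real.sin (a + h) - Real.sin a - h * Real.cos a| ≤ 2 * h ^ 2 := by
  have := abs_cos_add_sub_le (a - Real.pi / 2) h
  rwa [show a - Real.pi / 2 + h = (a + h) - Real.pi / 2 by ring, Real.cos_sub_pi_div_two,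
    Real.cos_sub_pi_div_two, Real.sin_sub_pi_div_two, mul_neg, ← sub_eq_add_neg] at this

namespace DelayCoeffs

variable {q d : ℝ → ℝ} {Z : Set ℝ} {Q : ℝ}

theorem trig_integrable (h : DelayCoeffs q d Z Q) {s : ℝ → ℝ} (hs : ContinuousOn s Zᶜ)
    (hs1 : ∀ x, |s x| ≤ 1) (a b : ℝ) : IntervalIntegrable (fun τ => q τ * s τ) volume a b := by
  refine intervalIntegrable_of_continuousOn_compl h.countable h.closed (B := Q * 1)
    (g := fun τ => q τ * s τ) (h.q_cont.mul hs) ?_ a b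
  intro τ hτ
  rw [abs_mul]
  exact mul_le_mul (h.q_le τ hτ) (hs1 τ) (abs_nonneg _) h.nonneg

theorem abs_trig_le (h : DelayCoeffs q d Z Q) {s : ℝ → ℝ} {B : ℝ} (hB : 0 ≤ B) {x : ℝ}
    (hx : x ∈ Icc 0 Real.pi) (hs1 : ∀ τ ∈ Zᶜ, τ ∈ Icc 0 x → |s τ| ≤ B) :
    |∫ τ in (0 : ℝ)..x, q τ * s τ| ≤ Q * B * Real.pi := by
  refine abs_integral_le_pi h.countable (mul_nonneg h.nonneg hB) hx ?_
  intro τ hτ hτx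
  rw [abs_mul]
  exact mul_le_mul (h.q_le τ hτ) (hs1 τ hτ hτx) (abs_nonneg _) h.nonneg

theorem cos_cont (h : DelayCoeffs q d Z Q) (μ : ℝ) :
    ContinuousOn (fun τ => Real.cos (μ * (τ - d τ))) Zᶜ := by
  have := h.d_cont
  fun_prop

theorem sin_cont (h : DelayCoeffs q d Z Q) (μ : ℝ) :
    ContinuousOn (fun τ => Real.sin (μ * (τ - d τ))) Zᶜ := by
  have := h.d_cont
  fun_prop

theorem abs_delayCos_le (h : DelayCoeffs q d Z Q) (μ : ℝ) {x : ℝ} (hx : x ∈ Icc 0 Real.pi) :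
    |delayCos q d μ x| ≤ Q * Real.pi :=
  (h.abs_trig_le zero_le_one hx fun _ _ _ => Real.abs_cos_le_one _).trans_eq (by ring)

theorem abs_delaySin_le (h : DelayCoeffs q d Z Q) (μ : ℝ) {x : ℝ} (hx : x ∈ Icc 0 Real.pi) :
    |delaySin q d μ x| ≤ Q * Real.pi :=
  (h.abs_trig_le zero_le_one hx fun _ _ _ => Real.abs_sin_le_one _).trans_eq (by ring)

theorem abs_phase_sub_le (h : DelayCoeffs q d Z Q) (μ ν : ℝ) {x τ : ℝ}
    (hx : x ∈ Icc 0 Real.pi) (hτ : τ ∈ Zᶜ) (hτx : τ ∈ Icc 0 x) :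
    |μ * (τ - d τ) - ν * (τ - d τ)| ≤ Real.pi * |μ - ν| := by
  rw [← sub_mul, abs_mul, mul_comm]
  refine mul_le_mul_of_nonneg_right (abs_le.2 ?_) (abs_nonneg _)
  have := h.d_mem τ hτ
  constructor <;> linarith [this.1, this.2, hτx.1, hτx.2, hx.2]

theorem abs_delayCos_sub_le (h : DelayCoeffs q d Z Q) (μ ν : ℝ) {x : ℝ}
    (hx : x ∈ Icc 0 Real.pi) :
    |delayCos q d μ x - delayCos q d ν x| ≤ Q * Real.pi * Real.pi * |μ - ν| := by
  unfold delayCos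
  rw [← intervalIntegral.integral_sub
    (h.trig_integrable (h.cos_cont μ) (fun _ => Real.abs_cos_le_one _) 0 x)
    (h.trig_integrable (h.cos_cont ν) (fun _ => Real.abs_cos_le_one _) 0 x)]
  simp only [← mul_sub]
  refine (h.abs_trig_le (B := Real.pi * |μ - ν|) (by positivity) hx ?_).trans_eq (by ring)
  exact fun τ hτ hτx => (Real.abs_cos_sub_cos_le _ _).trans (h.abs_phase_sub_le μ ν hx hτ hτx)

theorem abs_delaySin_sub_le (h : DelayCoeffs q d Z Q) (μ ν : ℝ) {x : ℝ}
    (hx : x ∈ Icc 0 Real.pi) :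
    |delaySin q d μ x - delaySin q d ν x| ≤ Q * Real.pi * Real.pi * |μ - ν| := by
  unfold delaySin
  rw [← intervalIntegral.integral_sub
    (h.trig_integrable (h.sin_cont μ) (fun _ => Real.abs_sin_le_one _) 0 x)
    (h.trig_integrable (h.sin_cont ν) (fun _ => Real.abs_sin_le_one _) 0 x)]
  simp only [← mul_sub]
  refine (h.abs_trig_le (B := Real.pi * |μ - ν|) (by positivity) hx ?_).trans_eq (by ring)
  exact fun τ hτ hτx => (Real.abs_sin_sub_sin_le _ _).trans (h.abs_phase_sub_le μ ν hx hτ hτx)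

/-- The Volterra operator on the free solution: resonant part plus oscillating part. -/
theorem volterra_free (h : DelayCoeffs q d Z Q) (μ x : ℝ) :
    volterra q d (fun t => Real.cos (μ * t) - Real.sin (μ * t)) μ 0 x =
      (Real.sin (μ * x) * (delayCos q d μ x + delaySin q d μ x)
        + Real.cos (μ * x) * (delayCos q d μ x - delaySin q d μ x)) / 2
      - (∫ τ in (0 : ℝ)..x, q τ * Real.sin (μ * (τ + d τ) + -(μ * x))) / 2
      - (∫ τ in (0 : ℝ)..x, q τ * Real.sin (μ * (τ + d τ) + (-(μ * x) + Real.pi / 2))) / 2 := by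
  have hd := h.d_cont
  have i1 := h.trig_integrable (h.cos_cont μ) (fun _ => Real.abs_cos_le_one _) 0 x
  have i2 := h.trig_integrable (h.sin_cont μ) (fun _ => Real.abs_sin_le_one _) 0 x
  have i3 := fun c => h.trig_integrable (s := fun τ => Real.sin (μ * (τ + d τ) + c))
    (by fun_prop) (fun _ => Real.abs_sin_le_one _) 0 x
  -- Product-to-sum formulas. The cosine of the phase with τ + d(τ) is written as a sine shifted by
  -- π/2, so that `Oscillates` covers both oscillating integrals.
  have key : ∀ τ, q τ * (Real.cos (μ * d τ) - Real.sin (μ * d τ)) * Real.sin (μ * (x - τ) + 0) =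
      (Real.sin (μ * x) + Real.cos (μ * x)) / 2 * (q τ * Real.cos (μ * (τ - d τ)))
      + (Real.sin (μ * x) - Real.cos (μ * x)) / 2 * (q τ * Real.sin (μ * (τ - d τ)))
      - 1 / 2 * (q τ * Real.sin (μ * (τ + d τ) + -(μ * x)))
      - 1 / 2 * (q τ * Real.sin (μ * (τ + d τ) + (-(μ * x) + Real.pi / 2))) := by
    intro τ
    rw [← add_assoc, Real.sin_add_pi_div_two, add_zero, mul_sub μ x τ, mul_sub μ τ, mul_add μ τ,
      ← sub_eq_add_neg]
    simp only [Real.sin_sub, Real.cos_sub, Real.sin_add, Real.cos_add]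
    have hx := Real.sin_sq_add_cos_sq (μ * x)
    ring
  unfold volterra
  simp only [key]
  rw [intervalIntegral.integral_sub
      (((i1.const_mul _).add (i2.const_mul _)).sub ((i3 _).const_mul _)) ((i3 _).const_mul _),
    intervalIntegral.integral_sub ((i1.const_mul _).add (i2.const_mul _)) ((i3 _).const_mul _),
    intervalIntegral.integral_add (i1.const_mul _) (i2.const_mul _)]
  simp only [intervalIntegral.integral_const_mul]
  unfold delayCos delaySin
  ring

/-- One Picard step: `u` differs from the free solution by O(1/μ), so replacing it inside the
Volterra integral, which carries another 1/μ, costs O(1/μ²). The oscillating part of `volterra_free`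
costs the same. -/
theorem abs_sub_firstOrder_le (h : DelayCoeffs q d Z Q) {J : ℝ} (hJ : Oscillates q d J) {μ : ℝ}
    (hμ0 : 0 < μ) (hμ : 2 * Q * Real.pi ≤ μ) {u : ℝ → ℝ} (hu : IsVolterra q d μ 1 u)
    {x : ℝ} (hx : x ∈ Icc 0 Real.pi) :
    |u x - (Real.cos (μ * x) * (1 + (delaySin q d μ x - delayCos q d μ x) / 2 / μ)
      - Real.sin (μ * x) * (1 + (delaySin q d μ x + delayCos q d μ x) / 2 / μ))|
      ≤ (J + Q * (Q * 4 * Real.pi) * Real.pi) / μ ^ 2 := by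
  have hQ := h.nonneg
  have hb := h.bound hμ0 hμ hu
  have hf : Continuous fun t => Real.cos (μ * t) - Real.sin (μ * t) := by fun_prop
  have h1 : ∀ t ∈ Icc 0 Real.pi, |u t - (Real.cos (μ * t) - Real.sin (μ * t))|
      ≤ Q * 4 * Real.pi / μ := by
    intro t ht
    rw [hu.2 t ht, one_mul, sub_sub_cancel_left, abs_neg, abs_div, abs_of_pos hμ0]
    exact div_le_div_of_nonneg_right (h.abs_volterra_le (by norm_num) hb μ 0 ht) hμ0.le
  have hπ := Real.pi_pos
  have h2 := h.abs_volterra_le (by positivity) h1 μ 0 hx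
  rw [← h.volterra_sub hu.1 hf] at h2
  have h3 := hJ μ (-(μ * x)) hμ0 x hx
  have h4 := hJ μ (-(μ * x) + Real.pi / 2) hμ0 x hx
  have hfree := h.volterra_free μ x
  set I₁ := ∫ τ in (0 : ℝ)..x, q τ * Real.sin (μ * (τ + d τ) + -(μ * x))
  set I₂ := ∫ τ in (0 : ℝ)..x, q τ * Real.sin (μ * (τ + d τ) + (-(μ * x) + Real.pi / 2))
  set V := volterra q d (fun t => Real.cos (μ * t) - Real.sin (μ * t)) μ 0 x
  have e : u x - (Real.cos (μ * x) * (1 + (delaySin q d μ x - delayCos q d μ x) / 2 / μ)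
      - Real.sin (μ * x) * (1 + (delaySin q d μ x + delayCos q d μ x) / 2 / μ))
      = (I₁ / 2 + I₂ / 2 - (volterra q d u μ 0 x - V)) / μ := by
    rw [hu.2 x hx, hfree]
    field_simp
    ring
  rw [e, abs_div, abs_of_pos hμ0, sq, ← div_div]
  refine div_le_div_of_nonneg_right ?_ hμ0.le
  have h5 := abs_sub (I₁ / 2 + I₂ / 2) (volterra q d u μ 0 x - V)
  have h6 := abs_add_le (I₁ / 2) (I₂ / 2)
  rw [abs_div, abs_div, abs_two] at h6
  rw [add_div]
  have h7 : Q * (Q * 4 * Real.pi / μ) * Real.pi = Q * (Q * 4 * Real.pi) * Real.pi / μ := by ring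
  linarith

end DelayCoeffs

/-- Extraction of the second term of the root from the characteristic equation. -/
theorem abs_shift_le {N : ℕ} {ε μ A S C K : ℝ} (hμ : μ = N + 1 / 4 + ε) (hN : 1 ≤ (N : ℝ))
    (hNμ : (N : ℝ) ≤ μ) {M : ℝ} (hM : 0 ≤ M) (hK : 0 ≤ K) (hε : |ε| ≤ M / N) (hS : |S| ≤ A)
    (hC : |C| ≤ A)
    (h : |Real.cos (μ * Real.pi) * (1 + (S - C) / 2 / μ)
      - Real.sin (μ * Real.pi) * (1 + (S + C) / 2 / μ)
      - (Real.sin (μ * Real.pi) + Real.cos (μ * Real.pi)) / μ| ≤ K / μ ^ 2) :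
    |2 * Real.pi * ε + (2 + C) / μ| ≤
      (2 * K + 4 * (Real.pi * M) ^ 2 + 2 * (Real.pi * M) ^ 2 * (A + 2) + Real.pi * M * A)
        / (N : ℝ) ^ 2 := by
  have hπ := Real.pi_pos
  have hN0 : (0 : ℝ) < N := by linarith
  have hμ0 : 0 < μ := by linarith
  have hA : 0 ≤ A := (abs_nonneg _).trans hS
  obtain ⟨η, hη⟩ : ∃ η, η = ε * Real.pi := ⟨_, rfl⟩
  have hηle : |η| ≤ Real.pi * M / N := by
    rw [hη, abs_mul, abs_of_pos hπ, mul_div_assoc, mul_comm]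
    exact mul_le_mul_of_nonneg_left hε hπ.le
  have hηsq : η ^ 2 ≤ (Real.pi * M) ^ 2 / (N : ℝ) ^ 2 := by
    rw [← div_pow, ← sq_abs]
    exact pow_le_pow_left₀ (abs_nonneg _) hηle 2
  have hc : Real.cos (μ * Real.pi) = (-1) ^ N * (√2 / 2 * (Real.cos η - Real.sin η)) := by
    rw [hμ, show ((N : ℝ) + 1 / 4 + ε) * Real.pi = (η + Real.pi / 4) + N * Real.pi by
      rw [hη]; ring, Real.cos_add_nat_mul_pi, Real.cos_add, Real.cos_pi_div_four,
      Real.sin_pi_div_four]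
    ring
  have hs : Real.sin (μ * Real.pi) = (-1) ^ N * (√2 / 2 * (Real.cos η + Real.sin η)) := by
    rw [hμ, show ((N : ℝ) + 1 / 4 + ε) * Real.pi = (η + Real.pi / 4) + N * Real.pi by
      rw [hη]; ring, Real.sin_add_nat_mul_pi, Real.sin_add, Real.cos_pi_div_four,
      Real.sin_pi_div_four]
    ring
  -- Up to the factor ±√2/2, `X` is the left side of the characteristic equation after the angle π/4
  -- + Nπ has been split off.
  obtain ⟨X, hX⟩ : ∃ X, X = 2 * Real.sin η + Real.cos η * (C + 2) / μ + Real.sin η * S / μ :=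
    ⟨_, rfl⟩
  have hX1 : |X| ≤ 2 * (K / μ ^ 2) := by
    have e : Real.cos (μ * Real.pi) * (1 + (S - C) / 2 / μ)
      - Real.sin (μ * Real.pi) * (1 + (S + C) / 2 / μ)
      - (Real.sin (μ * Real.pi) + Real.cos (μ * Real.pi)) / μ = -((-1) ^ N * (√2 / 2 * X)) := by
      rw [hc, hs, hX]
      field_simp
      ring
    rw [e, abs_neg, abs_mul, abs_pow, abs_neg, abs_one, one_pow, one_mul, abs_mul,
      abs_of_pos (by positivity)] at h
    have hs2 : (1 : ℝ) ≤ √2 := by rw [Real.one_le_sqrt]; norm_num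
    nlinarith [abs_nonneg X]
  have hX2 : |X| ≤ 2 * K / (N : ℝ) ^ 2 := by
    refine hX1.trans ?_
    rw [mul_div_assoc]
    refine mul_le_mul_of_nonneg_left ?_ (by norm_num)
    exact div_le_div_of_nonneg_left hK (by positivity) (pow_le_pow_left₀ hN0.le hNμ 2)
  have t1 : |Real.sin η - η| ≤ 2 * η ^ 2 := by simpa using abs_sin_add_sub_le 0 η
  have t2 : |Real.cos η - 1| ≤ 2 * η ^ 2 := by simpa using abs_cos_add_sub_le 0 η
  have t3 : |Real.sin η| ≤ |η| := by simpa using Real.abs_sin_sub_sin_le η 0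
  have e : 2 * Real.pi * ε + (2 + C) / μ = X - 2 * (Real.sin η - η)
      - (Real.cos η - 1) * (C + 2) / μ - Real.sin η * S / μ := by
    rw [hX, hη]; ring
  have b1 : |2 * (Real.sin η - η)| ≤ 4 * (Real.pi * M) ^ 2 / (N : ℝ) ^ 2 := by
    rw [abs_mul, abs_two, mul_div_assoc]; linarith
  have b2 : |(Real.cos η - 1) * (C + 2) / μ|
      ≤ 2 * (Real.pi * M) ^ 2 * (A + 2) / (N : ℝ) ^ 2 := by
    rw [abs_div, abs_of_pos hμ0]
    refine (div_le_self (abs_nonneg _) (by linarith)).trans ?_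
    have hC2 : |C + 2| ≤ A + 2 := (abs_add_le _ _).trans (by rw [abs_two]; linarith)
    rw [abs_mul]
    refine (mul_le_mul t2 hC2 (abs_nonneg _) (by positivity)).trans ?_
    rw [mul_div_right_comm, mul_div_assoc]
    exact mul_le_mul_of_nonneg_right (by linarith) (by linarith)
  have b3 : |Real.sin η * S / μ| ≤ Real.pi * M * A / (N : ℝ) ^ 2 := by
    rw [abs_div, abs_mul, abs_of_pos hμ0]
    have : |Real.sin η| * |S| ≤ Real.pi * M / N * A :=
      mul_le_mul (t3.trans hηle) hS (abs_nonneg _) (by positivity)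
    refine (div_le_div₀ (by positivity) this hN0 hNμ).trans_eq ?_
    field_simp
  rw [e]
  have c1 := abs_sub (X - 2 * (Real.sin η - η) - (Real.cos η - 1) * (C + 2) / μ)
    (Real.sin η * S / μ)
  have c2 := abs_sub (X - 2 * (Real.sin η - η)) ((Real.cos η - 1) * (C + 2) / μ)
  have c3 := abs_sub X (2 * (Real.sin η - η))
  rw [add_div, add_div, add_div]
  linarith

/-- In a correction already of order 1/N, moving the trigonometric factor and the integrals from μ
to N + 1/4, and the denominator from μ to N, changes only terms of order 1/N². -/
theorem abs_mul_div_sub_mul_div_le {s s₀ a a₀ μ N B D E : ℝ} (hN : 0 < N) (hNμ : N ≤ μ)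
    (hs1 : |s| ≤ 1) (hs₀1 : |s₀| ≤ 1) (hs : |s - s₀| ≤ D / N) (ha : |a - a₀| ≤ E / N)
    (ha₀ : |a₀| ≤ B) (hμ : μ - N ≤ 1) :
    |s * (a / μ) - s₀ * (a₀ / N)| ≤ (E + D * B + B) / N ^ 2 := by
  have hμ0 : 0 < μ := by linarith
  have hB : 0 ≤ B := (abs_nonneg _).trans ha₀
  have e : s * (a / μ) - s₀ * (a₀ / N) =
      s * (a - a₀) / μ + (s - s₀) * a₀ / μ - s₀ * a₀ * (μ - N) / (μ * N) := by
    field_simp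
    ring
  have hE : 0 ≤ E / N := (abs_nonneg _).trans ha
  have hD : 0 ≤ D / N := (abs_nonneg _).trans hs
  have b1 : |s * (a - a₀) / μ| ≤ E / N ^ 2 := by
    rw [abs_div, abs_mul, abs_of_pos hμ0]
    refine (div_le_div₀ (c := 1 * (E / N)) (by positivity)
      (mul_le_mul hs1 ha (abs_nonneg _) zero_le_one) hN hNμ).trans_eq ?_
    field_simp
  have b2 : |(s - s₀) * a₀ / μ| ≤ D * B / N ^ 2 := by
    rw [abs_div, abs_mul, abs_of_pos hμ0]
    refine (div_le_div₀ (c := D / N * B) (by positivity)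
      (mul_le_mul hs ha₀ (abs_nonneg _) hD) hN hNμ).trans_eq ?_
    field_simp
  have b3 : |s₀ * a₀ * (μ - N) / (μ * N)| ≤ B / N ^ 2 := by
    rw [abs_div, abs_mul, abs_mul, abs_of_pos (mul_pos hμ0 hN), abs_of_nonneg (sub_nonneg.2 hNμ)]
    refine div_le_div₀ hB ?_ (by positivity) (by nlinarith)
    have h1 : |s₀| * |a₀| ≤ 1 * B := mul_le_mul hs₀1 ha₀ (abs_nonneg _) zero_le_one
    have h2 := mul_le_mul h1 hμ (sub_nonneg.2 hNμ) (by linarith)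
    linarith
  rw [e, add_div, add_div]
  have c1 := abs_sub (s * (a - a₀) / μ + (s - s₀) * a₀ / μ) (s₀ * a₀ * (μ - N) / (μ * N))
  have c2 := abs_add_le (s * (a - a₀) / μ) ((s - s₀) * a₀ / μ)
  linarith

namespace DelayCoeffs

variable {q d : ℝ → ℝ} {Z : Set ℝ} {Q : ℝ}

theorem exists_refinedExpansion (h : DelayCoeffs q d Z Q) {J : ℝ} (hJ : Oscillates q d J)
    {M : ℝ} (hM : 0 ≤ M) :
    ∃ K, ∀ (N : ℕ) (μ : ℝ), 1 ≤ (N : ℝ) → 2 * Q * Real.pi ≤ N → |(N : ℝ) + 1 / 4 - μ| < 1 / 4 →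
      |μ - ((N : ℝ) + 1 / 4)| ≤ M / N → ∀ u, IsVolterra q d μ 1 u →
      Real.cos (μ * Real.pi) - Real.sin (μ * Real.pi) = charRemainder q d u μ →
      ∀ x ∈ Icc 0 Real.pi, |u x - refinedExpansion q d N (N + 1 / 4) x| ≤ K / (N : ℝ) ^ 2 := by
  have hπ := Real.pi_pos
  have hQ := h.nonneg
  have hpi : Real.pi ∈ Icc 0 Real.pi := ⟨hπ.le, le_rfl⟩
  have hJ0 : 0 ≤ J := by simpa using (abs_nonneg _).trans (hJ 1 0 one_pos Real.pi hpi)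
  obtain ⟨K₁, hK₁⟩ : ∃ K₁, K₁ = J + Q * (Q * 4 * Real.pi) * Real.pi := ⟨_, rfl⟩
  have hK₁0 : 0 ≤ K₁ := by rw [hK₁]; positivity
  obtain ⟨K₂, hK₂⟩ : ∃ K₂, K₂ = 2 * (K₁ + Q * 4 * Real.pi) + 4 * (Real.pi * M) ^ 2
    + 2 * (Real.pi * M) ^ 2 * (Q * Real.pi + 2) + Real.pi * M * (Q * Real.pi) := ⟨_, rfl⟩
  obtain ⟨K₃, hK₃⟩ : ∃ K₃, K₃ = K₂ + (Q * Real.pi * Real.pi + (2 + Q * Real.pi)) * M := ⟨_, rfl⟩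
  obtain ⟨K₄, hK₄⟩ : ∃ K₄, K₄ = Q * Real.pi * Real.pi * M + (Real.pi * M) * (Q * Real.pi)
    + Q * Real.pi := ⟨_, rfl⟩
  refine ⟨K₁ + 4 * (Real.pi * M) ^ 2 + K₃ + 2 * K₄, ?_⟩
  intro N μ hN1 hNQ hμN hμM u hu hroot x hx
  have hN0 : (0 : ℝ) < N := by linarith
  have hab := abs_lt.1 hμN
  have hNμ : (N : ℝ) ≤ μ := by linarith
  have hμ1 : 1 ≤ μ := by linarith
  have hμ0 : 0 < μ := by linarith
  have hμQ : 2 * Q * Real.pi ≤ μ := by linarith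
  have hNsq : ∀ a : ℝ, 0 ≤ a → a / μ ^ 2 ≤ a / (N : ℝ) ^ 2 := fun a ha =>
    div_le_div_of_nonneg_left ha (by positivity) (pow_le_pow_left₀ hN0.le hNμ 2)
  obtain ⟨ν, hν⟩ : ∃ ν : ℝ, ν = N + 1 / 4 := ⟨_, rfl⟩
  obtain ⟨ε, hε⟩ : ∃ ε : ℝ, ε = μ - ν := ⟨_, rfl⟩
  have hεM : |ε| ≤ M / N := by rw [hε, hν]; exact hμM
  have hν1 : 1 ≤ ν := by linarith
  have hν0 : 0 < ν := by linarith
  have hb := h.bound hμ0 hμQ hu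
  -- the characteristic equation determines `ε` up to `O(1/N²)`
  have hchar : |2 * Real.pi * ε + (2 + delayCos q d μ Real.pi) / μ| ≤ K₂ / (N : ℝ) ^ 2 := by
    have h1 := h.abs_sub_firstOrder_le hJ hμ0 hμQ hu hpi
    have h2 := h.abs_volterra_le (by norm_num) hb μ (Real.pi / 2) hpi
    rw [hK₂]
    refine abs_shift_le (by rw [hε, hν]; ring) hN1 hNμ hM (by positivity) hεM
      (h.abs_delaySin_le μ hpi) (h.abs_delayCos_le μ hpi) ?_
    rw [← hK₁] at h1
    have h3 : |volterra q d u μ (Real.pi / 2) Real.pi / μ ^ 2| ≤ Q * 4 * Real.pi / μ ^ 2 := by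
      rw [abs_div, abs_of_pos (by positivity : 0 < μ ^ 2)]
      exact div_le_div_of_nonneg_right h2 (by positivity)
    -- At a root, u(π) equals (sin μπ + cos μπ)/μ plus a Volterra term over μ², so the first-order
    -- expansion at π becomes an equation for ε.
    have hu' := hu.2 Real.pi hpi
    unfold charRemainder at hroot
    have e : ∀ F : ℝ, F - (Real.sin (μ * Real.pi) + Real.cos (μ * Real.pi)) / μ
        = -(u Real.pi - F) + volterra q d u μ (Real.pi / 2) Real.pi / μ ^ 2 := by
      intro F
      rw [hu', one_mul, hroot, sq, ← div_div]
      ring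
    rw [e, add_div (K₁) _ (μ ^ 2)]
    refine (abs_add_le _ _).trans ?_
    rw [abs_neg]
    exact add_le_add h1 h3
  have hshift : |ε + (2 + delayCos q d ν Real.pi) / ν / (2 * Real.pi)|
      ≤ K₃ / (N : ℝ) ^ 2 / (2 * Real.pi) := by
    have h1 : |(2 + delayCos q d μ Real.pi) / μ - (2 + delayCos q d ν Real.pi) / ν|
        ≤ (Q * Real.pi * Real.pi + (2 + Q * Real.pi)) * M / (N : ℝ) ^ 2 := by
      refine (abs_div_sub_div_le (A := Q * Real.pi * Real.pi) (B := 2 + Q * Real.pi) hμ1 hν1 ?_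
        ?_).trans ?_
      · rw [add_sub_add_left_eq_sub]
        exact h.abs_delayCos_sub_le μ ν hpi
      · refine (abs_add_le _ _).trans ?_
        rw [abs_two]
        linarith [h.abs_delayCos_le ν hpi]
      · rw [← hε]
        refine (div_le_div₀ (c := (Q * Real.pi * Real.pi + (2 + Q * Real.pi)) * (M / N))
          (by positivity) (mul_le_mul_of_nonneg_left hεM (by positivity)) hN0 hNμ).trans_eq ?_
        field_simp
    have e : ε + (2 + delayCos q d ν Real.pi) / ν / (2 * Real.pi)
        = ((2 * Real.pi * ε + (2 + delayCos q d μ Real.pi) / μ)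
          - ((2 + delayCos q d μ Real.pi) / μ - (2 + delayCos q d ν Real.pi) / ν))
          / (2 * Real.pi) := by
      field_simp
      ring
    rw [e, abs_div, abs_of_pos (by positivity : 0 < 2 * Real.pi)]
    refine div_le_div_of_nonneg_right ?_ (by positivity)
    rw [hK₃, add_div K₂]
    exact (abs_sub _ _).trans (add_le_add hchar h1)
  have hεx : |ε * x| ≤ Real.pi * M / N := by
    rw [abs_mul, abs_of_nonneg hx.1, mul_div_assoc, mul_comm]
    exact mul_le_mul hx.2 hεM (abs_nonneg _) hπ.le
  have hεx2 : (ε * x) ^ 2 ≤ (Real.pi * M) ^ 2 / (N : ℝ) ^ 2 := by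
    rw [← div_pow, ← sq_abs]
    exact pow_le_pow_left₀ (abs_nonneg _) hεx 2
  have hμx : μ * x = ν * x + ε * x := by rw [hε]; ring
  have hfirst := h.abs_sub_firstOrder_le hJ hμ0 hμQ hu hx
  rw [← hK₁] at hfirst
  have hfirst' := hfirst.trans (hNsq K₁ hK₁0)
  have hcos := abs_cos_add_sub_le (ν * x) (ε * x)
  have hsin := abs_sin_add_sub_le (ν * x) (ε * x)
  have hcos' : |Real.cos (μ * x) - Real.cos (ν * x)| ≤ Real.pi * M / N := by
    refine (Real.abs_cos_sub_cos_le _ _).trans ?_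
    rwa [hμx, add_sub_cancel_left]
  have hsin' : |Real.sin (μ * x) - Real.sin (ν * x)| ≤ Real.pi * M / N := by
    refine (Real.abs_sin_sub_sin_le _ _).trans ?_
    rwa [hμx, add_sub_cancel_left]
  rw [← hμx] at hcos hsin
  have hlip : ∀ a b a₀ b₀ : ℝ, |a - a₀| ≤ Q * Real.pi * Real.pi * |μ - ν| →
      |b - b₀| ≤ Q * Real.pi * Real.pi * |μ - ν| →
      |(a - b) / 2 - (a₀ - b₀) / 2| ≤ Q * Real.pi * Real.pi * M / N ∧
      |(a + b) / 2 - (a₀ + b₀) / 2| ≤ Q * Real.pi * Real.pi * M / N := by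
    intro a b a₀ b₀ ha hb
    have hle : Q * Real.pi * Real.pi * |μ - ν| ≤ Q * Real.pi * Real.pi * M / N := by
      rw [mul_div_assoc, ← hε]
      exact mul_le_mul_of_nonneg_left hεM (by positivity)
    have ha' := abs_le.1 (ha.trans hle)
    have hb' := abs_le.1 (hb.trans hle)
    constructor <;> rw [abs_le] <;> constructor <;> linarith [ha'.1, ha'.2, hb'.1, hb'.2]
  have hsz : ∀ a b : ℝ, |a| ≤ Q * Real.pi → |b| ≤ Q * Real.pi →
      |(a - b) / 2| ≤ Q * Real.pi ∧ |(a + b) / 2| ≤ Q * Real.pi := by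
    intro a b ha hb
    have ha' := abs_le.1 ha
    have hb' := abs_le.1 hb
    constructor <;> rw [abs_le] <;> constructor <;> linarith [ha'.1, ha'.2, hb'.1, hb'.2]
  obtain ⟨hl1, hl2⟩ := hlip _ _ _ _ (h.abs_delaySin_sub_le μ ν hx) (h.abs_delayCos_sub_le μ ν hx)
  obtain ⟨hz1, hz2⟩ := hsz _ _ (h.abs_delaySin_le ν hx) (h.abs_delayCos_le ν hx)
  have hp1 := abs_mul_div_sub_mul_div_le hN0 hNμ (Real.abs_cos_le_one (μ * x))
    (Real.abs_cos_le_one (ν * x)) hcos' hl1 hz1 (by linarith)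
  have hp2 := abs_mul_div_sub_mul_div_le hN0 hNμ (Real.abs_sin_le_one (μ * x))
    (Real.abs_sin_le_one (ν * x)) hsin' hl2 hz2 (by linarith)
  rw [← hK₄] at hp1 hp2
  have hlin : |(ε + (2 + delayCos q d ν Real.pi) / ν / (2 * Real.pi)) * x
      * (Real.cos (ν * x) + Real.sin (ν * x))| ≤ K₃ / (N : ℝ) ^ 2 := by
    have h2 : |Real.cos (ν * x) + Real.sin (ν * x)| ≤ 2 := (abs_add_le _ _).trans
      (by linarith [Real.abs_sin_le_one (ν * x), Real.abs_cos_le_one (ν * x)])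
    rw [abs_mul, abs_mul, abs_of_nonneg hx.1]
    have hnn := (abs_nonneg _).trans hshift
    refine (mul_le_mul (mul_le_mul hshift hx.2 hx.1 hnn) h2 (abs_nonneg _)
      (mul_nonneg hnn hπ.le)).trans_eq ?_
    field_simp
  rw [← hν]
  unfold refinedExpansion
  generalize delaySin q d μ x = S at *
  generalize delayCos q d μ x = C at *
  generalize delaySin q d ν x = S₀ at *
  generalize delayCos q d ν x = C₀ at *
  generalize (2 + delayCos q d ν Real.pi) / ν / (2 * Real.pi) = κ at *
  generalize Real.cos (ν * x) = c₀ at *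
  generalize Real.sin (ν * x) = s₀ at *
  generalize Real.cos (μ * x) = c at *
  generalize Real.sin (μ * x) = s at *
  -- The error splits into that of the first-order expansion, the Taylor remainders of cosine and
  -- sine, the error of the root shift, and the two changes in the 1/N corrections.
  have e : u x - (c₀ * (1 + (S₀ - C₀) / 2 / N) - s₀ * (1 + (S₀ + C₀) / 2 / N) + κ * x * (c₀ + s₀))
      = (u x - (c * (1 + (S - C) / 2 / μ) - s * (1 + (S + C) / 2 / μ)))
        + (c - c₀ + ε * x * s₀) - (s - s₀ - ε * x * c₀)
        - (ε + κ) * x * (c₀ + s₀)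
        + (c * ((S - C) / 2 / μ) - c₀ * ((S₀ - C₀) / 2 / N))
        - (s * ((S + C) / 2 / μ) - s₀ * ((S₀ + C₀) / 2 / N)) := by
    ring
  rw [e]
  have q1 := abs_le.1 hfirst'
  have q2 := abs_le.1 hcos
  have q3 := abs_le.1 hsin
  have q4 := abs_le.1 hlin
  have q5 := abs_le.1 hp1
  have q6 := abs_le.1 hp2
  have e3 : (K₁ + 4 * (Real.pi * M) ^ 2 + K₃ + 2 * K₄) / (N : ℝ) ^ 2 =
      K₁ / (N : ℝ) ^ 2 + 4 * ((Real.pi * M) ^ 2 / (N : ℝ) ^ 2) + K₃ / (N : ℝ) ^ 2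
      + 2 * (K₄ / (N : ℝ) ^ 2) := by ring
  rw [e3, abs_le]
  constructor <;> linarith [q1.1, q1.2, q2.1, q2.2, q3.1, q3.2, q4.1, q4.2, q5.1, q5.2, q6.1, q6.2]

end DelayCoeffs

/-! ### Nonstationary phase. -/

/-- Nonstationary phase: integration by parts on a compact subinterval of an open interval on which
the phase `τ + d(τ)` has derivative at least one. -/
theorem abs_integral_mul_sin_le {q d q' d' d'' : ℝ → ℝ} {A B Q M₁ M₂ : ℝ}
    (hq : ∀ x ∈ Ioo A B, HasDerivAt q (q' x) x) (hd : ∀ x ∈ Ioo A B, HasDerivAt d (d' x) x)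
    (hd' : ∀ x ∈ Ioo A B, HasDerivAt d' (d'' x) x) (hpos : ∀ x ∈ Ioo A B, 0 ≤ d' x)
    (hQ : ∀ x ∈ Ioo A B, |q x| ≤ Q) (hM₁ : ∀ x ∈ Ioo A B, |q' x| ≤ M₁)
    (hM₂ : ∀ x ∈ Ioo A B, |d'' x| ≤ M₂) {μ : ℝ} (hμ : 0 < μ) (c : ℝ) {a b : ℝ}
    (ha : a ∈ Ioo A B) (hb : b ∈ Ioo A B) (hab : a ≤ b) :
    |∫ τ in a..b, q τ * Real.sin (μ * (τ + d τ) + c)| ≤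
      (2 * Q + (M₁ + Q * M₂) * (B - A)) / μ := by
  have hsub : Icc a b ⊆ Ioo A B := fun x hx => ⟨ha.1.trans_le hx.1, hx.2.trans_lt hb.2⟩
  have hQ0 : 0 ≤ Q := (abs_nonneg _).trans (hQ a ha)
  have hM₁0 : 0 ≤ M₁ := (abs_nonneg _).trans (hM₁ a ha)
  have hM₂0 : 0 ≤ M₂ := (abs_nonneg _).trans (hM₂ a ha)
  have h1 : ∀ x ∈ Ioo A B, 1 ≤ 1 + d' x := fun x hx => by linarith [hpos x hx]
  -- The integrand is written as f g', where g' carries the derivative 1 + d' of the phase and g is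
  -- bounded by 1/μ.
  let f : ℝ → ℝ := fun x => q x / (1 + d' x)
  let f' : ℝ → ℝ := fun x => (q' x * (1 + d' x) - q x * d'' x) / (1 + d' x) ^ 2
  have hf : ∀ x ∈ Ioo A B, HasDerivAt f (f' x) x := fun x hx =>
    (hq x hx).div ((hd' x hx).const_add 1) (by linarith [h1 x hx])
  have hfle : ∀ x ∈ Ioo A B, |f x| ≤ Q := fun x hx => by
    simp only [f]
    rw [abs_div, abs_of_pos (by linarith [h1 x hx] : 0 < 1 + d' x)]
    exact (div_le_self (abs_nonneg _) (h1 x hx)).trans (hQ x hx)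
  have hf'le : ∀ x ∈ Ioo A B, |f' x| ≤ M₁ + Q * M₂ := fun x hx => by
    have hp := h1 x hx
    have hp0 : 0 < 1 + d' x := by linarith
    have e : f' x = q' x / (1 + d' x) - q x * d'' x / (1 + d' x) ^ 2 := by
      simp only [f']
      field_simp
    rw [e]
    refine (abs_sub _ _).trans (add_le_add ?_ ?_)
    · rw [abs_div, abs_of_pos hp0]
      exact (div_le_self (abs_nonneg _) hp).trans (hM₁ x hx)
    · rw [abs_div, abs_mul, abs_of_pos (pow_pos hp0 2)]
      exact (div_le_self (by positivity) (one_le_pow₀ hp)).trans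
        (mul_le_mul (hQ x hx) (hM₂ x hx) (abs_nonneg _) hQ0)
  let g : ℝ → ℝ := fun x => -Real.cos (μ * (x + d x) + c) / μ
  let g' : ℝ → ℝ := fun x => (1 + d' x) * Real.sin (μ * (x + d x) + c)
  have hg : ∀ x ∈ Ioo A B, HasDerivAt g (g' x) x := fun x hx => by
    have h2 := ((((hasDerivAt_id x).add (hd x hx)).const_mul μ).add_const c).cos.neg.div_const μ
    convert! h2 using 1
    simp only [g', id, Pi.add_apply]
    field_simp
  have hgle : ∀ x, |g x| ≤ 1 / μ := fun x => by
    simp only [g]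
    rw [abs_div, abs_neg, abs_of_pos hμ]
    exact div_le_div_of_nonneg_right (Real.abs_cos_le_one _) hμ.le
  have hdc : ContinuousOn d (Icc a b) := fun x hx =>
    (hd x (hsub hx)).continuousAt.continuousWithinAt
  have hd'c : ContinuousOn d' (Icc a b) := fun x hx =>
    (hd' x (hsub hx)).continuousAt.continuousWithinAt
  have hg'i : IntervalIntegrable g' volume a b := by
    apply ContinuousOn.intervalIntegrable
    rw [uIcc_of_le hab]
    fun_prop
  have hf'i : IntervalIntegrable f' volume a b := by
    -- Continuity of `q'` and `d''` is not assumed; integrability comes from measurability of every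
    -- derivative together with the bound `hf'le`.
    have h0 : IntervalIntegrable (deriv f) volume a b := by
      refine (intervalIntegrable_const (E := ℝ) (c := M₁ + Q * M₂)).mono_fun
        (measurable_deriv f).aestronglyMeasurable ?_
      rw [uIoc_of_le hab]
      refine (ae_restrict_mem measurableSet_Ioc).mono fun x hx => ?_
      have hx' := hsub ⟨hx.1.le, hx.2⟩
      change ‖deriv f x‖ ≤ ‖M₁ + Q * M₂‖
      rw [(hf x hx').deriv, Real.norm_eq_abs, Real.norm_eq_abs]
      exact (hf'le x hx').trans (le_abs_self _)
    refine h0.congr fun x hx => ?_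
    rw [uIoc_of_le hab] at hx
    exact (hf x (hsub ⟨hx.1.le, hx.2⟩)).deriv
  have hparts := intervalIntegral.integral_mul_deriv_eq_deriv_mul (u := f) (v := g) (u' := f')
    (v' := g') (a := a) (b := b) (fun x hx => hf x (hsub (by rwa [uIcc_of_le hab] at hx)))
    (fun x hx => hg x (hsub (by rwa [uIcc_of_le hab] at hx))) hf'i hg'i
  have hint : ∫ τ in a..b, q τ * Real.sin (μ * (τ + d τ) + c) = ∫ τ in a..b, f τ * g' τ := by
    refine intervalIntegral.integral_congr fun x hx => ?_
    rw [uIcc_of_le hab] at hx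
    have := h1 x (hsub hx)
    simp only [f, g']
    field_simp
  have hrest : |∫ x in a..b, f' x * g x| ≤ (M₁ + Q * M₂) * (1 / μ) * (B - A) := by
    have h0 : ‖∫ x in a..b, f' x * g x‖ ≤ (M₁ + Q * M₂) * (1 / μ) * |b - a| := by
      refine intervalIntegral.norm_integral_le_of_norm_le_const fun x hx => ?_
      rw [uIoc_of_le hab] at hx
      rw [Real.norm_eq_abs, abs_mul]
      exact mul_le_mul (hf'le x (hsub ⟨hx.1.le, hx.2⟩)) (hgle x) (abs_nonneg _) (by positivity)
    refine h0.trans (mul_le_mul_of_nonneg_left ?_ (by positivity))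
    rw [abs_of_nonneg (by linarith)]
    linarith [ha.1, hb.2]
  have hend : ∀ x ∈ Ioo A B, |f x * g x| ≤ Q * (1 / μ) := fun x hx => by
    rw [abs_mul]
    exact mul_le_mul (hfle x hx) (hgle x) (abs_nonneg _) hQ0
  rw [hint, hparts]
  have c1 := abs_sub (f b * g b - f a * g a) (∫ x in a..b, f' x * g x)
  have c2 := abs_sub (f b * g b) (f a * g a)
  have e : (2 * Q + (M₁ + Q * M₂) * (B - A)) / μ
      = Q * (1 / μ) + Q * (1 / μ) + (M₁ + Q * M₂) * (1 / μ) * (B - A) := by ring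
  rw [e]
  linarith [hend a ha, hend b hb]

/-- Bounds for increments of a continuous function pass from an open interval to its closure. -/
theorem abs_sub_le_of_Ioo {F : ℝ → ℝ} (hF : Continuous F) {A B K : ℝ} (hAB : A < B)
    (h : ∀ a ∈ Ioo A B, ∀ b ∈ Ioo A B, a ≤ b → |F b - F a| ≤ K) :
    ∀ a ∈ Icc A B, ∀ b ∈ Icc A B, |F b - F a| ≤ K := by
  have hcl : IsClosed {p : ℝ × ℝ | |F p.2 - F p.1| ≤ K} :=
    isClosed_le (by fun_prop) continuous_const
  have hsub : Ioo A B ×ˢ Ioo A B ⊆ {p : ℝ × ℝ | |F p.2 - F p.1| ≤ K} := by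
    rintro ⟨a, b⟩ ⟨ha, hb⟩
    rcases le_total a b with hab | hab
    · exact h a ha b hb hab
    · have := h b hb a ha hab
      rwa [abs_sub_comm] at this
  have := hcl.closure_subset_iff.2 hsub
  rw [closure_prod_eq, closure_Ioo hAB.ne] at this
  exact fun a ha b hb => this (show (a, b) ∈ Icc A B ×ˢ Icc A B from ⟨ha, hb⟩)

/-! ### Passage between the differential and the integral equation. -/

namespace DelayCoeffs

variable {q d : ℝ → ℝ} {Z : Set ℝ} {Q : ℝ}

/-- Variation of parameters: a piecewise classical solution satisfies the Volterra equation. -/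
theorem variation (h : DelayCoeffs q d Z Q) {μ : ℝ} {w v : ℝ → ℝ} (hw : Continuous w)
    (hv : Continuous v) (hwd : ∀ t ∈ Ioo 0 Real.pi \ Z, HasDerivAt w (v t) t)
    (hvd : ∀ t ∈ Ioo 0 Real.pi \ Z, HasDerivAt v (-(q t * w (d t)) - μ ^ 2 * w t) t)
    (c : ℝ) {x : ℝ} (hx : x ∈ Icc 0 Real.pi) :
    μ * w x * Real.cos c + v x * Real.sin c =
      μ * w 0 * Real.cos (μ * x + c) + v 0 * Real.sin (μ * x + c) - volterra q d w μ c x := by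
  -- In the `t`-derivative of this expression everything cancels except the delayed term; the values
  -- at t = x and t = 0 give the two sides.
  have hF : Continuous fun t => μ * w t * Real.cos (μ * (x - t) + c)
      + v t * Real.sin (μ * (x - t) + c) := by fun_prop
  have := integral_eq_of_hasDerivAt_off_countable_of_le
    (fun t => μ * w t * Real.cos (μ * (x - t) + c) + v t * Real.sin (μ * (x - t) + c))
    (fun t => -(q t * w (d t) * Real.sin (μ * (x - t) + c))) hx.1 h.countable hF.continuousOn ?_
    (h.volterra_integrable hw μ c x 0 x).neg
  · rw [intervalIntegral.integral_neg] at this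
    unfold volterra
    simp only [sub_self, mul_zero, zero_add, sub_zero] at this
    linarith
  · intro t ht
    have ht' : t ∈ Ioo 0 Real.pi \ Z := ⟨⟨ht.1.1, ht.1.2.trans_le hx.2⟩, ht.2⟩
    have hl : HasDerivAt (fun t => μ * (x - t) + c) (-μ) t := by
      simpa using (((hasDerivAt_id t).const_sub x).const_mul μ).add_const c
    convert! (((hwd t ht').const_mul μ).mul hl.cos).add ((hvd t ht').mul hl.sin) using 1
    ring

/-- The right-hand side of the Volterra equation, as a function on the real line. -/
def _root_.volterraExt (q d u : ℝ → ℝ) (μ x : ℝ) : ℝ :=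
  Real.cos (μ * x) - Real.sin (μ * x) - volterra q d u μ 0 x / μ

/-- The derivative of `volterraExt`. -/
def _root_.volterraExtDeriv (q d u : ℝ → ℝ) (μ x : ℝ) : ℝ :=
  -(μ * (Real.sin (μ * x) + Real.cos (μ * x))) - volterra q d u μ (Real.pi / 2) x

theorem _root_.IsVolterra.eqOn_volterraExt {μ : ℝ} {u : ℝ → ℝ} (hu : IsVolterra q d μ 1 u) :
    EqOn u (volterraExt q d u μ) (Icc 0 Real.pi) := fun x hx => by
  rw [hu.2 x hx, one_mul]; rfl

theorem hasDerivAt_volterraExt (h : DelayCoeffs q d Z Q) {u : ℝ → ℝ} (hu : Continuous u) {μ : ℝ}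
    (hμ : μ ≠ 0) (x : ℝ) :
    HasDerivAt (volterraExt q d u μ) (volterraExtDeriv q d u μ x) x := by
  have hl : HasDerivAt (fun y => μ * y) μ x := by
    simpa using (hasDerivAt_id x).const_mul μ
  convert! (hl.cos.sub hl.sin).sub ((h.hasDerivAt_volterra_zero hu μ x).div_const μ) using 1
  unfold volterraExtDeriv
  field_simp
  ring

theorem hasDerivAt_volterraExtDeriv (h : DelayCoeffs q d Z Q) {μ : ℝ} (hμ : μ ≠ 0) {u : ℝ → ℝ}
    (hu : IsVolterra q d μ 1 u) {x : ℝ} (hx : x ∈ Zᶜ) :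
    HasDerivAt (volterraExtDeriv q d u μ)
      (-(q x * volterraExt q d u μ (d x)) - μ ^ 2 * volterraExt q d u μ x) x := by
  have hl : HasDerivAt (fun y => μ * y) μ x := by
    simpa using (hasDerivAt_id x).const_mul μ
  -- Two phase shifts by π/2 reverse the sign of the kernel, which produces the term -μ² u.
  have hpi : volterra q d u μ (Real.pi / 2 + Real.pi / 2) x = -volterra q d u μ 0 x := by
    unfold volterra
    rw [← intervalIntegral.integral_neg]
    congr 1
    ext τ
    rw [add_halves, Real.sin_add_pi, add_zero, mul_neg]
  convert! ((hl.sin.add hl.cos).const_mul μ).neg.sub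
    (h.hasDerivAt_volterra hu.1 μ (Real.pi / 2) hx) using 1
  rw [hpi, ← hu.eqOn_volterraExt (h.d_mem x hx), Real.sin_pi_div_two]
  unfold volterraExt
  field_simp
  ring

end DelayCoeffs

/-! ### Extension beyond [0, π] and gluing of three pieces. -/

/-- The nearest point of `[0, π]`. -/
def clampPi (t : ℝ) : ℝ := max 0 (min Real.pi t)

theorem continuous_clampPi : Continuous clampPi := by unfold clampPi; fun_prop

theorem clampPi_of_mem {t : ℝ} (ht : t ∈ Icc 0 Real.pi) : clampPi t = t := by
  unfold clampPi
  rw [min_eq_right ht.2, max_eq_right ht.1]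

theorem clampPi_mem (t : ℝ) : clampPi t ∈ Icc 0 Real.pi :=
  ⟨le_max_left _ _, max_le Real.pi_pos.le (min_le_left _ _)⟩

/-- Interior points have no other preimage, so extending the coefficients by clamping creates no
discontinuities beyond the two jumps. -/
theorem clampPi_eq {t c : ℝ} (hc : c ∈ Ioo 0 Real.pi) (h : clampPi t = c) : t = c := by
  unfold clampPi at h
  obtain ⟨h0, h1⟩ := hc
  rcases max_choice 0 (min Real.pi t) with h2 | h2 <;> rw [h2] at h
  · linarith
  · rcases min_choice Real.pi t with h3 | h3 <;> rw [h3] at h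
    · linarith
    · exact h

/-- Three functions on the adjacent intervals `[0, a]`, `[a, b]`, `[b, π]`, glued together. -/
def glue (a b : ℝ) (f₁ f₂ f₃ : ℝ → ℝ) (t : ℝ) : ℝ :=
  f₁ (max 0 (min a t)) + (f₂ (max a (min b t)) - f₂ a) + (f₃ (max b (min Real.pi t)) - f₃ b)

section glue

variable {a b : ℝ} {f₁ f₂ f₃ : ℝ → ℝ}

/-- As `glue` adds up increments, continuity needs no matching at `a` and `b`; matching matters only
for identifying the values on the second and third intervals. -/
theorem continuous_glue (ha : 0 ≤ a) (hab : a ≤ b) (hb : b ≤ Real.pi)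
    (h₁ : ContinuousOn f₁ (Icc 0 a)) (h₂ : ContinuousOn f₂ (Icc a b))
    (h₃ : ContinuousOn f₃ (Icc b Real.pi)) : Continuous (glue a b f₁ f₂ f₃) := by
  have key : ∀ {f : ℝ → ℝ} {l r : ℝ}, l ≤ r → ContinuousOn f (Icc l r) →
      Continuous fun t => f (max l (min r t)) := fun hlr hf =>
    hf.comp_continuous (by fun_prop) fun t => ⟨le_max_left _ _, max_le hlr (min_le_left _ _)⟩
  unfold glue
  have k₁ := key ha h₁
  have k₂ := key hab h₂
  have k₃ := key hb h₃
  exact (k₁.add (k₂.sub continuous_const)).add (k₃.sub continuous_const)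

theorem glue_first (hab : a ≤ b) (hb : b ≤ Real.pi) {t : ℝ} (ht : t ∈ Icc 0 a) :
    glue a b f₁ f₂ f₃ t = f₁ t := by
  unfold glue
  rw [min_eq_right ht.2, max_eq_right ht.1, min_eq_right (ht.2.trans hab), max_eq_left ht.2,
    min_eq_right ((ht.2.trans hab).trans hb), max_eq_left (ht.2.trans hab)]
  ring

theorem glue_second (ha : 0 ≤ a) (hb : b ≤ Real.pi) (h : f₁ a = f₂ a) {t : ℝ}
    (ht : t ∈ Icc a b) : glue a b f₁ f₂ f₃ t = f₂ t := by
  unfold glue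
  rw [min_eq_left ht.1, max_eq_right ha, min_eq_right ht.2, max_eq_right ht.1,
    min_eq_right (ht.2.trans hb), max_eq_left ht.2, h]
  ring

theorem glue_third (ha : 0 ≤ a) (hab : a ≤ b) (h : f₁ a = f₂ a) (h' : f₂ b = f₃ b) {t : ℝ}
    (ht : t ∈ Icc b Real.pi) : glue a b f₁ f₂ f₃ t = f₃ t := by
  unfold glue
  rw [min_eq_left (hab.trans ht.1), max_eq_right ha, min_eq_left ht.1, max_eq_right hab,
    min_eq_right ht.2, max_eq_right ht.1, h, h']
  ring

end glue

/-! ### Reduction of the transmission problem to a single Volterra equation. -/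

namespace RetardedProblem

variable {P : RetardedProblem}

/-- The coefficient `q`, extended to the real line by its boundary values. -/
def qExt (P : RetardedProblem) (τ : ℝ) : ℝ := P.q (clampPi τ)

/-- The deviated argument `x - Δ(x)`, extended to the real line. -/
def dExt (P : RetardedProblem) (τ : ℝ) : ℝ := clampPi τ - P.Δ (clampPi τ)

/-- The two points of discontinuity. -/
def jumps (P : RetardedProblem) : Set ℝ := {P.h₁, P.h₂}

theorem notMem_jumps {x : ℝ} : x ∈ P.jumpsᶜ ↔ x ≠ P.h₁ ∧ x ≠ P.h₂ := by
  simp [jumps]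

theorem finite_jumps : P.jumps.Finite := by simp [jumps]

theorem mem_dom_iff (hP : P.Standing) {x : ℝ} :
    x ∈ P.dom ↔ x ∈ Icc 0 Real.pi ∧ x ∈ P.jumpsᶜ := by
  have h1 := hP.h₁_pos
  have h2 := hP.h₁_lt_h₂
  have h3 := hP.h₂_lt_pi
  rw [notMem_jumps]
  simp only [dom, mem_union, mem_Ico, mem_Ioo, mem_Ioc, mem_Icc]
  constructor
  · rintro ((⟨a, b⟩ | ⟨a, b⟩) | ⟨a, b⟩) <;> refine ⟨⟨?_, ?_⟩, ?_, ?_⟩ <;> linarith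
  · rintro ⟨⟨a, b⟩, c, e⟩
    rcases lt_or_gt_of_ne c with c | c
    · exact Or.inl (Or.inl ⟨a, c⟩)
    · rcases lt_or_gt_of_ne e with e | e
      · exact Or.inl (Or.inr ⟨c, e⟩)
      · exact Or.inr ⟨e, b⟩

theorem clampPi_mem_dom (hP : P.Standing) {x : ℝ} (hx : x ∈ P.jumpsᶜ) : clampPi x ∈ P.dom := by
  have h1 := hP.h₁_pos
  have h2 := hP.h₁_lt_h₂
  have h3 := hP.h₂_lt_pi
  rw [notMem_jumps] at hx
  rw [mem_dom_iff hP, notMem_jumps]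
  exact ⟨clampPi_mem x, fun h => hx.1 (clampPi_eq ⟨h1, by linarith⟩ h),
    fun h => hx.2 (clampPi_eq ⟨by linarith, h3⟩ h)⟩

/-- The hypothesis stops short of π; continuity of Δ at π supplies the endpoint. -/
theorem sub_delay_third (hP : P.Standing) {x : ℝ} (hx : x ∈ Ioc P.h₂ Real.pi) :
    P.h₂ ≤ x - P.Δ x := by
  rcases hx.2.lt_or_eq with h | rfl
  · exact hP.Δ_third x ⟨hx.1, h⟩
  · have hsub : Ioo P.h₂ Real.pi ⊆ P.dom := fun y hy => Or.inr ⟨hy.1, hy.2.le⟩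
    have hΔ : ContinuousWithinAt P.Δ (Ioo P.h₂ Real.pi) Real.pi :=
      (hP.Δ_cont _ (Or.inr hx)).mono hsub
    refine ContinuousWithinAt.closure_le (s := Ioo P.h₂ Real.pi) (f := fun _ => P.h₂)
      (g := fun y => y - P.Δ y) ?_ continuousWithinAt_const (continuousWithinAt_id.sub hΔ)
      hP.Δ_third
    rw [closure_Ioo hP.h₂_lt_pi.ne]
    exact ⟨hP.h₂_lt_pi.le, le_rfl⟩

theorem sub_delay_mem (hP : P.Standing) {x : ℝ} (hx : x ∈ P.dom) :
    x - P.Δ x ∈ Icc 0 Real.pi := by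
  have h1 := hP.h₁_pos
  have h2 := hP.h₁_lt_h₂
  have hx' := ((mem_dom_iff hP).1 hx).1
  refine ⟨?_, by linarith [hP.Δ_nonneg x hx, hx'.2]⟩
  rcases hx with (hx | hx) | hx
  · exact hP.Δ_first x hx
  · linarith [hP.Δ_second x hx]
  · linarith [sub_delay_third hP hx]

/-- The mean value inequality on a single piece, from the bound on q'. -/
theorem exists_q_bound_of_convex (ha : P.CondA) {s : Set ℝ} (hs : Convex ℝ s)
    (hsub : s ⊆ P.dom) (hne : s.Nonempty) (hπ : s ⊆ Icc 0 Real.pi) :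
    ∃ B, ∀ x ∈ s, |P.q x| ≤ B := by
  obtain ⟨M, hM⟩ := ha.q_bdd
  obtain ⟨x₀, hx₀⟩ := hne
  refine ⟨|P.q x₀| + M * Real.pi, fun x hx => ?_⟩
  have h1 := hs.norm_image_sub_le_of_norm_hasDerivWithin_le (f := P.q)
    (fun y hy => ((ha.q_diff y (hsub hy)).hasDerivWithinAt).mono hsub)
    (fun y hy => hM y (hsub hy)) hx₀ hx
  rw [Real.norm_eq_abs, Real.norm_eq_abs] at h1
  have hM0 : 0 ≤ M := (abs_nonneg _).trans (hM x (hsub hx))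
  have h2 : |x - x₀| ≤ Real.pi := by
    have p1 := hπ hx
    have p2 := hπ hx₀
    rw [abs_le]
    constructor <;> linarith [p1.1, p1.2, p2.1, p2.2]
  have h3 := mul_le_mul_of_nonneg_left h2 hM0
  have h4 := abs_sub_abs_le_abs_sub (P.q x) (P.q x₀)
  linarith

theorem exists_q_bound (hP : P.Standing) (ha : P.CondA) :
    ∃ Q, 0 ≤ Q ∧ ∀ x ∈ P.dom, |P.q x| ≤ Q := by
  have h1 := hP.h₁_pos
  have h2 := hP.h₁_lt_h₂
  have h3 := hP.h₂_lt_pi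
  have hπ : P.dom ⊆ Icc 0 Real.pi := fun x hx => ((mem_dom_iff hP).1 hx).1
  have s1 : Ico 0 P.h₁ ⊆ P.dom := fun x hx => Or.inl (Or.inl hx)
  have s2 : Ioo P.h₁ P.h₂ ⊆ P.dom := fun x hx => Or.inl (Or.inr hx)
  have s3 : Ioc P.h₂ Real.pi ⊆ P.dom := fun x hx => Or.inr hx
  obtain ⟨B₁, hB₁⟩ := exists_q_bound_of_convex ha (convex_Ico 0 P.h₁) s1 (nonempty_Ico.2 h1)
    (s1.trans hπ)
  obtain ⟨B₂, hB₂⟩ := exists_q_bound_of_convex ha (convex_Ioo P.h₁ P.h₂) s2 (nonempty_Ioo.2 h2)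
    (s2.trans hπ)
  obtain ⟨B₃, hB₃⟩ := exists_q_bound_of_convex ha (convex_Ioc P.h₂ Real.pi) s3
    (nonempty_Ioc.2 h3) (s3.trans hπ)
  refine ⟨max 0 (max B₁ (max B₂ B₃)), le_max_left _ _, ?_⟩
  rintro x ((hx | hx) | hx)
  · exact (hB₁ x hx).trans (by simp)
  · exact (hB₂ x hx).trans (by simp)
  · exact (hB₃ x hx).trans (by simp)

theorem delayCoeffs (hP : P.Standing) {Q : ℝ} (hQ0 : 0 ≤ Q) (hQ : ∀ x ∈ P.dom, |P.q x| ≤ Q) :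
    DelayCoeffs P.qExt P.dExt P.jumps Q where
  countable := finite_jumps.countable
  closed := finite_jumps.isClosed
  nonneg := hQ0
  q_cont := hP.q_cont.comp continuous_clampPi.continuousOn fun _ hx => clampPi_mem_dom hP hx
  d_cont := continuous_clampPi.continuousOn.sub
    (hP.Δ_cont.comp continuous_clampPi.continuousOn fun _ hx => clampPi_mem_dom hP hx)
  q_le := fun _ hx => hQ _ (clampPi_mem_dom hP hx)
  d_mem := fun _ hx => sub_delay_mem hP (clampPi_mem_dom hP hx)

theorem dom_mem_nhds (hP : P.Standing) {x : ℝ} (hx : x ∈ Ioo 0 Real.pi \ P.jumps) :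
    P.dom ∈ 𝓝 x := by
  have ho : IsOpen (Ioo 0 Real.pi \ P.jumps) := isOpen_Ioo.sdiff finite_jumps.isClosed
  exact mem_of_superset (ho.mem_nhds hx) fun y hy =>
    (mem_dom_iff hP).2 ⟨⟨hy.1.1.le, hy.1.2.le⟩, hy.2⟩

/-- Here d' = 1 - Δ' ≥ 0 by condition (b), so the phase τ + d(τ) is nonstationary. Each of the three
pieces contributes at most K/μ. -/
theorem exists_oscillates (hP : P.Standing) (ha : P.CondA) (hb : P.CondB) {Q : ℝ} (hQ0 : 0 ≤ Q)
    (hQ : ∀ x ∈ P.dom, |P.q x| ≤ Q) : ∃ J, Oscillates P.qExt P.dExt J := by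
  have h1 := hP.h₁_pos
  have h2 := hP.h₁_lt_h₂
  have h3 := hP.h₂_lt_pi
  have h := delayCoeffs hP hQ0 hQ
  obtain ⟨M₁, hM₁⟩ := ha.q_bdd
  obtain ⟨M₂, hM₂⟩ := ha.Δ_bdd
  have h0dom : (0 : ℝ) ∈ P.dom := Or.inl (Or.inl ⟨le_rfl, h1⟩)
  have hM₁0 : 0 ≤ M₁ := (abs_nonneg _).trans (hM₁ 0 h0dom)
  have hM₂0 : 0 ≤ M₂ := (abs_nonneg _).trans (hM₂ 0 h0dom)
  obtain ⟨K, hK⟩ : ∃ K, K = 2 * Q + (M₁ + Q * M₂) * Real.pi := ⟨_, rfl⟩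
  refine ⟨3 * K, fun μ c hμ x hx => ?_⟩
  have hcont : ContinuousOn (fun τ => Real.sin (μ * (τ + P.dExt τ) + c)) P.jumpsᶜ := by
    have := h.d_cont
    fun_prop
  have hint := h.trig_integrable hcont (fun _ => Real.abs_sin_le_one _)
  let F : ℝ → ℝ := fun y => ∫ τ in (0 : ℝ)..y, P.qExt τ * Real.sin (μ * (τ + P.dExt τ) + c)
  have hF : Continuous F := intervalIntegral.continuous_primitive hint 0
  have piece : ∀ A B : ℝ, 0 ≤ A → A < B → B ≤ Real.pi → Ioo A B ⊆ P.jumpsᶜ →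
      ∀ a ∈ Icc A B, ∀ b ∈ Icc A B, |F b - F a| ≤ K / μ := by
    intro A B hA hAB hB hZ
    -- Two-sided derivatives are available only inside the piece; continuity of the primitive
    -- extends the bound to the endpoints.
    refine abs_sub_le_of_Ioo hF hAB fun a ha' b hb' hab => ?_
    have hmem : ∀ y ∈ Ioo A B, y ∈ Ioo 0 Real.pi \ P.jumps := fun y hy =>
      ⟨⟨hA.trans_lt hy.1, hy.2.trans_le hB⟩, hZ hy⟩
    have hdom : ∀ y ∈ Ioo A B, y ∈ P.dom := fun y hy => mem_of_mem_nhds (dom_mem_nhds hP (hmem y hy))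
    have key := abs_integral_mul_sin_le (q := P.q) (d := fun y => y - P.Δ y)
      (q' := derivWithin P.q P.dom) (d' := fun y => 1 - derivWithin P.Δ P.dom y)
      (d'' := fun y => -derivWithin (derivWithin P.Δ P.dom) P.dom y) (A := A) (B := B)
      (Q := Q) (M₁ := M₁) (M₂ := M₂)
      (fun y hy => (ha.q_diff y (hdom y hy)).hasDerivWithinAt.hasDerivAt
        (dom_mem_nhds hP (hmem y hy)))
      (fun y hy => (hasDerivAt_id y).sub
        ((ha.Δ_diff y (hdom y hy)).hasDerivWithinAt.hasDerivAt (dom_mem_nhds hP (hmem y hy))))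
      (fun y hy => ((ha.Δ_diff₂ y (hdom y hy)).hasDerivWithinAt.hasDerivAt
        (dom_mem_nhds hP (hmem y hy))).const_sub 1)
      (fun y hy => by linarith [hb.deriv_le y (hdom y hy)])
      (fun y hy => hQ y (hdom y hy)) (fun y hy => hM₁ y (hdom y hy))
      (fun y hy => by rw [abs_neg]; exact hM₂ y (hdom y hy)) hμ c ha' hb' hab
    have e : F b - F a = ∫ τ in a..b, P.q τ * Real.sin (μ * (τ + (τ - P.Δ τ)) + c) := by
      simp only [F]
      rw [intervalIntegral.integral_interval_sub_left (hint 0 b) (hint 0 a)]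
      refine intervalIntegral.integral_congr fun y hy => ?_
      rw [uIcc_of_le hab] at hy
      have hy' : clampPi y = y := clampPi_of_mem
        ⟨by linarith [ha'.1, hy.1], by linarith [hb'.2, hy.2]⟩
      simp only [qExt, dExt, hy']
    rw [e]
    refine key.trans (div_le_div_of_nonneg_right ?_ hμ.le)
    rw [hK]
    have : (M₁ + Q * M₂) * (B - A) ≤ (M₁ + Q * M₂) * Real.pi :=
      mul_le_mul_of_nonneg_left (by linarith) (by positivity)
    linarith
  have p1 := piece 0 P.h₁ le_rfl h1 (by linarith) fun y hy =>
    notMem_jumps.2 ⟨hy.2.ne, (hy.2.trans h2).ne⟩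
  have p2 := piece P.h₁ P.h₂ h1.le h2 h3.le fun y hy => notMem_jumps.2 ⟨hy.1.ne', hy.2.ne⟩
  have p3 := piece P.h₂ Real.pi (by linarith) h3 le_rfl fun y hy =>
    notMem_jumps.2 ⟨(h2.trans hy.1).ne', hy.1.ne'⟩
  have hF0 : F 0 = 0 := intervalIntegral.integral_same
  change |F x| ≤ 3 * K / μ
  have e : F x = F x - F 0 := by rw [hF0, sub_zero]
  have hKμ : 0 ≤ K / μ := (abs_nonneg _).trans (p1 0 ⟨le_rfl, h1.le⟩ 0 ⟨le_rfl, h1.le⟩)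
  rw [mul_div_assoc, e]
  rcases le_total x P.h₁ with hx1 | hx1
  · linarith [p1 0 ⟨le_rfl, h1.le⟩ x ⟨hx.1, hx1⟩]
  · have q1 := p1 0 ⟨le_rfl, h1.le⟩ P.h₁ ⟨h1.le, le_rfl⟩
    rcases le_total x P.h₂ with hx2 | hx2
    · have q2 := p2 P.h₁ ⟨le_rfl, h2.le⟩ x ⟨hx1, hx2⟩
      linarith [abs_sub_le (F x) (F P.h₁) (F 0)]
    · have q2 := p2 P.h₁ ⟨le_rfl, h2.le⟩ P.h₂ ⟨h2.le, le_rfl⟩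
      have q3 := p3 P.h₂ ⟨le_rfl, h3.le⟩ x ⟨hx2, hx.2⟩
      linarith [abs_sub_le (F x) (F P.h₂) (F 0), abs_sub_le (F P.h₂) (F P.h₁) (F 0)]

theorem C_eq (N : ℕ) {x : ℝ} (hx : x ∈ Icc 0 Real.pi) :
    P.C N x = delayCos P.qExt P.dExt (N + 1 / 4) x := by
  refine intervalIntegral.integral_congr fun y hy => ?_
  rw [uIcc_of_le hx.1] at hy
  simp only [qExt, dExt, clampPi_of_mem ⟨hy.1, hy.2.trans hx.2⟩, sub_sub_cancel]

theorem S_eq (N : ℕ) {x : ℝ} (hx : x ∈ Icc 0 Real.pi) :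
    P.S N x = delaySin P.qExt P.dExt (N + 1 / 4) x := by
  refine intervalIntegral.integral_congr fun y hy => ?_
  rw [uIcc_of_le hx.1] at hy
  simp only [qExt, dExt, clampPi_of_mem ⟨hy.1, hy.2.trans hx.2⟩, sub_sub_cancel]

theorem expansion_eq {N : ℕ} (hN : 1 ≤ (N : ℝ)) {x : ℝ} (hx : x ∈ Icc 0 Real.pi) :
    P.expansion N x = refinedExpansion P.qExt P.dExt N (N + 1 / 4) x := by
  have hπ := Real.pi_pos
  have hN0 : (N : ℝ) ≠ 0 := by positivity
  have h1 : (4 * (N : ℝ) + 1) ≠ 0 := by positivity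
  have h2 : ((N : ℝ) + 1 / 4) ≠ 0 := by positivity
  unfold expansion refinedExpansion
  rw [C_eq N hx, S_eq N hx, C_eq N ⟨hπ.le, le_rfl⟩]
  have e : 2 * x / (Real.pi * (4 * (N : ℝ) + 1)) = x / (N + 1 / 4) / (2 * Real.pi) := by
    field_simp
    ring
  rw [e]
  ring

/-- The rescaled pieces of a solution, glued to a function on the whole interval. -/
def glued (P : RetardedProblem) (U : ThreePieces) : ℝ → ℝ :=
  glue P.h₁ P.h₂ U.y₁ (fun t => P.δ * U.y₂ t) (fun t => P.δ * P.θ * U.y₃ t)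

/-- The derivative of `glued`. -/
def gluedDeriv (P : RetardedProblem) (U : ThreePieces) : ℝ → ℝ :=
  glue P.h₁ P.h₂ (derivWithin U.y₁ (Icc 0 P.h₁))
    (fun t => P.δ * derivWithin U.y₂ (Icc P.h₁ P.h₂) t)
    (fun t => P.δ * P.θ * derivWithin U.y₃ (Icc P.h₂ Real.pi) t)

section glued

variable {μ : ℝ} {U : ThreePieces}

theorem continuous_glued (hP : P.Standing) (hU : P.IsSolution μ U) : Continuous (P.glued U) :=
  continuous_glue hP.h₁_pos.le hP.h₁_lt_h₂.le hP.h₂_lt_pi.le hU.eq₁.1.continuousOn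
    (continuousOn_const.mul hU.eq₂.1.continuousOn) (continuousOn_const.mul hU.eq₃.1.continuousOn)

theorem continuous_gluedDeriv (hP : P.Standing) (hU : P.IsSolution μ U) :
    Continuous (P.gluedDeriv U) :=
  continuous_glue hP.h₁_pos.le hP.h₁_lt_h₂.le hP.h₂_lt_pi.le hU.eq₁.2.1
    (continuousOn_const.mul hU.eq₂.2.1) (continuousOn_const.mul hU.eq₃.2.1)

theorem glued_first (hP : P.Standing) {t : ℝ} (ht : t ∈ Icc 0 P.h₁) :
    P.glued U t = U.y₁ t := glue_first hP.h₁_lt_h₂.le hP.h₂_lt_pi.le ht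

theorem gluedDeriv_first (hP : P.Standing) {t : ℝ} (ht : t ∈ Icc 0 P.h₁) :
    P.gluedDeriv U t = derivWithin U.y₁ (Icc 0 P.h₁) t :=
  glue_first hP.h₁_lt_h₂.le hP.h₂_lt_pi.le ht

theorem glued_second (hP : P.Standing) (hU : P.IsSolution μ U) {t : ℝ}
    (ht : t ∈ Icc P.h₁ P.h₂) : P.glued U t = P.δ * U.y₂ t :=
  glue_second (f₂ := fun t => P.δ * U.y₂ t) hP.h₁_pos.le hP.h₂_lt_pi.le
    (by linarith [hU.tc₁]) ht

theorem gluedDeriv_second (hP : P.Standing) (hU : P.IsSolution μ U) {t : ℝ}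
    (ht : t ∈ Icc P.h₁ P.h₂) : P.gluedDeriv U t = P.δ * derivWithin U.y₂ (Icc P.h₁ P.h₂) t :=
  glue_second (f₂ := fun t => P.δ * derivWithin U.y₂ (Icc P.h₁ P.h₂) t) hP.h₁_pos.le
    hP.h₂_lt_pi.le (by linarith [hU.tc₁']) ht

theorem glued_third (hP : P.Standing) (hU : P.IsSolution μ U) {t : ℝ}
    (ht : t ∈ Icc P.h₂ Real.pi) : P.glued U t = P.δ * P.θ * U.y₃ t :=
  glue_third (f₂ := fun t => P.δ * U.y₂ t) (f₃ := fun t => P.δ * P.θ * U.y₃ t) hP.h₁_pos.le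
    hP.h₁_lt_h₂.le (by linarith [hU.tc₁])
    (by linear_combination P.δ * hU.tc₂) ht

theorem gluedDeriv_third (hP : P.Standing) (hU : P.IsSolution μ U) {t : ℝ}
    (ht : t ∈ Icc P.h₂ Real.pi) :
    P.gluedDeriv U t = P.δ * P.θ * derivWithin U.y₃ (Icc P.h₂ Real.pi) t :=
  glue_third (f₂ := fun t => P.δ * derivWithin U.y₂ (Icc P.h₁ P.h₂) t)
    (f₃ := fun t => P.δ * P.θ * derivWithin U.y₃ (Icc P.h₂ Real.pi) t) hP.h₁_pos.le
    hP.h₁_lt_h₂.le (by linarith [hU.tc₁'])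
    (by linear_combination P.δ * hU.tc₂') ht

/-- On a piece, the rescaled solution and its derivative satisfy the first order system. -/
theorem hasDerivAt_of_solvesOn {y w v : ℝ → ℝ} {a b k : ℝ} {S : Set ℝ}
    (hy : P.SolvesOn μ y a b S) (hw : ∀ t ∈ Icc a b, w t = k * y t)
    (hv : ∀ t ∈ Icc a b, v t = k * derivWithin y (Icc a b) t) {t : ℝ} (ht : t ∈ Ioo a b)
    (htS : t ∈ S) (htπ : t ∈ Icc 0 Real.pi) (hd : t - P.Δ t ∈ Icc a b) :
    HasDerivAt w (v t) t ∧
      HasDerivAt v (-(P.qExt t * w (P.dExt t)) - μ ^ 2 * w t) t := by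
  have hn : Icc a b ∈ 𝓝 t := Icc_mem_nhds ht.1 ht.2
  have htI : t ∈ Icc a b := ⟨ht.1.le, ht.2.le⟩
  constructor
  · rw [hv t htI]
    refine (((hy.1 t htI).hasDerivWithinAt.hasDerivAt hn).const_mul k).congr_of_eventuallyEq ?_
    filter_upwards [hn] with s hs using hw s hs
  · obtain ⟨h1, h2⟩ := hy.2.2 t htS
    have e : -(P.qExt t * w (P.dExt t)) - μ ^ 2 * w t
        = k * derivWithin (derivWithin y (Icc a b)) (Icc a b) t := by
      simp only [qExt, dExt, clampPi_of_mem htπ]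
      rw [hw _ hd, hw t htI]
      linear_combination (-k) * h2
    rw [e]
    refine ((h1.hasDerivWithinAt.hasDerivAt hn).const_mul k).congr_of_eventuallyEq ?_
    filter_upwards [hn] with s hs using hv s hs

/-- The delayed argument lies in the closed piece containing `t`, so the same scaling factor
multiplies every term of the equation. -/
theorem hasDerivAt_glued (hP : P.Standing) (hU : P.IsSolution μ U) {t : ℝ}
    (ht : t ∈ Ioo 0 Real.pi \ P.jumps) :
    HasDerivAt (P.glued U) (P.gluedDeriv U t) t ∧ HasDerivAt (P.gluedDeriv U)
      (-(P.qExt t * P.glued U (P.dExt t)) - μ ^ 2 * P.glued U t) t := by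
  have hdom := mem_of_mem_nhds (dom_mem_nhds hP ht)
  have hΔ := hP.Δ_nonneg t hdom
  have htπ : t ∈ Icc 0 Real.pi := ⟨ht.1.1.le, ht.1.2.le⟩
  rcases hdom with (h | h) | h
  · exact hasDerivAt_of_solvesOn hU.eq₁ (k := 1)
      (fun s hs => by rw [one_mul]; exact glued_first hP hs)
      (fun s hs => by rw [one_mul]; exact gluedDeriv_first hP hs) ⟨ht.1.1, h.2⟩ h htπ
      ⟨hP.Δ_first t h, by linarith [h.2]⟩
  · exact hasDerivAt_of_solvesOn hU.eq₂ (fun s hs => glued_second hP hU hs)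
      (fun s hs => gluedDeriv_second hP hU hs) h h htπ ⟨hP.Δ_second t h, by linarith [h.2]⟩
  · exact hasDerivAt_of_solvesOn hU.eq₃ (fun s hs => glued_third hP hU hs)
      (fun s hs => gluedDeriv_third hP hU hs) ⟨h.1, ht.1.2⟩ h htπ
      ⟨sub_delay_third hP h, by linarith [h.2]⟩

/-- Variation of parameters with phase 0 gives the integral equation; with phase π/2 at x = π it
gives the derivative at π, which turns the boundary condition there into the characteristic
equation. -/
theorem isVolterra_glued (hP : P.Standing) {Q : ℝ}
    (h : DelayCoeffs P.qExt P.dExt P.jumps Q) (hμ : 0 < μ) (hU : P.IsSolution μ U) :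
    IsVolterra P.qExt P.dExt μ (U.y₁ 0) (P.glued U) ∧
      μ ^ 2 * P.glued U Real.pi - μ * U.y₁ 0 * (Real.sin (μ * Real.pi) + Real.cos (μ * Real.pi))
        - volterra P.qExt P.dExt (P.glued U) μ (Real.pi / 2) Real.pi = 0 := by
  have h0 : (0 : ℝ) ∈ Icc 0 P.h₁ := ⟨le_rfl, hP.h₁_pos.le⟩
  have hpi : Real.pi ∈ Icc P.h₂ Real.pi := ⟨hP.h₂_lt_pi.le, le_rfl⟩
  have hvar := h.variation (continuous_glued hP hU) (continuous_gluedDeriv hP hU)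
    (fun t ht => (hasDerivAt_glued hP hU ht).1) (fun t ht => (hasDerivAt_glued hP hU ht).2)
  have hv0 : P.gluedDeriv U 0 = -(μ * U.y₁ 0) := by
    rw [gluedDeriv_first hP h0]
    linarith [hU.bc_zero]
  refine ⟨⟨continuous_glued hP hU, fun x hx => ?_⟩, ?_⟩
  · have := hvar 0 hx
    rw [glued_first hP h0, hv0] at this
    simp only [Real.cos_zero, Real.sin_zero, add_zero, mul_one, mul_zero] at this
    field_simp
    linear_combination this
  · have := hvar (Real.pi / 2) (x := Real.pi) ⟨Real.pi_pos.le, le_rfl⟩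
    rw [glued_first hP h0, hv0, Real.cos_add_pi_div_two, Real.sin_add_pi_div_two,
      Real.cos_pi_div_two, Real.sin_pi_div_two, gluedDeriv_third hP hU hpi] at this
    rw [glued_third hP hU hpi] at this ⊢
    linear_combination (P.δ * P.θ) * hU.bc_pi - this

end glued

/-! ### Reconstruction of a solution from the Volterra equation. -/

/-- The solution of the problem built from a solution of the Volterra equation. -/
def ofVolterra (P : RetardedProblem) (μ : ℝ) (u : ℝ → ℝ) : ThreePieces where
  y₁ := fun t => 1 * volterraExt P.qExt P.dExt u μ t
  y₂ := fun t => P.δ⁻¹ * volterraExt P.qExt P.dExt u μ t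
  y₃ := fun t => (P.δ * P.θ)⁻¹ * volterraExt P.qExt P.dExt u μ t

section ofVolterra

variable {μ Q : ℝ} {u : ℝ → ℝ}

theorem derivWithin_smul_volterraExt (h : DelayCoeffs P.qExt P.dExt P.jumps Q) (hμ : μ ≠ 0)
    (hu : IsVolterra P.qExt P.dExt μ 1 u) (k : ℝ) {a b : ℝ} (hab : a < b) {x : ℝ}
    (hx : x ∈ Icc a b) :
    derivWithin (fun t => k * volterraExt P.qExt P.dExt u μ t) (Icc a b) x =
      k * volterraExtDeriv P.qExt P.dExt u μ x :=
  ((h.hasDerivAt_volterraExt hu.1 hμ x).const_mul k).hasDerivWithinAt.derivWithin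
    (uniqueDiffOn_Icc hab x hx)

theorem solvesOn_volterraExt (h : DelayCoeffs P.qExt P.dExt P.jumps Q) (hμ : μ ≠ 0)
    (hu : IsVolterra P.qExt P.dExt μ 1 u) (k : ℝ) {a b : ℝ} (hab : a < b) {S : Set ℝ}
    (hS : S ⊆ Icc a b) (hSπ : S ⊆ Icc 0 Real.pi) (hSj : S ⊆ P.jumpsᶜ) :
    P.SolvesOn μ (fun t => k * volterraExt P.qExt P.dExt u μ t) a b S := by
  have hd := fun x (hx : x ∈ Icc a b) => derivWithin_smul_volterraExt h hμ hu k hab hx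
  have hc : Continuous fun x => k * volterraExtDeriv P.qExt P.dExt u μ x := by
    have := h.continuous_volterra hu.1 μ (Real.pi / 2)
    unfold volterraExtDeriv
    fun_prop
  refine ⟨fun x _ => ((h.hasDerivAt_volterraExt hu.1 hμ x).const_mul
    k).differentiableAt.differentiableWithinAt, hc.continuousOn.congr hd, fun x hx => ?_⟩
  have h1 := (((h.hasDerivAt_volterraExtDeriv hμ hu (hSj hx)).const_mul k).hasDerivWithinAt
    (s := Icc a b)).congr hd (hd x (hS hx))
  refine ⟨h1.differentiableWithinAt, ?_⟩
  rw [h1.derivWithin (uniqueDiffOn_Icc hab x (hS hx))]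
  simp only [qExt, dExt, clampPi_of_mem (hSπ hx)]
  ring

/-- The pieces are multiples of one differentiable function, so the transmission conditions are
automatic; `hroot` is needed only for the condition at π. -/
theorem isSolution_ofVolterra (hP : P.Standing) (h : DelayCoeffs P.qExt P.dExt P.jumps Q)
    (hμ : 0 < μ) (hu : IsVolterra P.qExt P.dExt μ 1 u)
    (hroot : Real.cos (μ * Real.pi) - Real.sin (μ * Real.pi) =
      charRemainder P.qExt P.dExt u μ) : P.IsSolution μ (P.ofVolterra μ u) := by
  have h1 := hP.h₁_pos
  have h2 := hP.h₁_lt_h₂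
  have h3 := hP.h₂_lt_pi
  have hδ := hP.δ_ne
  have hθ := hP.θ_ne
  have hd := fun (k : ℝ) {a b : ℝ} (hab : a < b) {x : ℝ} (hx : x ∈ Icc a b) =>
    derivWithin_smul_volterraExt h hμ.ne' hu k hab hx
  have h12 : P.h₁ ∈ Icc P.h₁ P.h₂ := ⟨le_rfl, h2.le⟩
  have h01 : P.h₁ ∈ Icc 0 P.h₁ := ⟨h1.le, le_rfl⟩
  have h22 : P.h₂ ∈ Icc P.h₁ P.h₂ := ⟨h2.le, le_rfl⟩
  have h23 : P.h₂ ∈ Icc P.h₂ Real.pi := ⟨le_rfl, h3.le⟩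
  have hdom : ∀ {s : Set ℝ}, s ⊆ P.dom → s ⊆ Icc 0 Real.pi ∧ s ⊆ P.jumpsᶜ := fun hs =>
    ⟨fun x hx => ((mem_dom_iff hP).1 (hs hx)).1, fun x hx => ((mem_dom_iff hP).1 (hs hx)).2⟩
  have d1 := hdom (s := Ico 0 P.h₁) fun x hx => Or.inl (Or.inl hx)
  have d2 := hdom (s := Ioo P.h₁ P.h₂) fun x hx => Or.inl (Or.inr hx)
  have d3 := hdom (s := Ioc P.h₂ Real.pi) fun x hx => Or.inr hx
  refine ⟨solvesOn_volterraExt h hμ.ne' hu 1 h1 Ico_subset_Icc_self d1.1 d1.2,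
    solvesOn_volterraExt h hμ.ne' hu _ h2 Ioo_subset_Icc_self d2.1 d2.2,
    solvesOn_volterraExt h hμ.ne' hu _ h3 Ioc_subset_Icc_self d3.1 d3.2, ?_, ?_, ?_, ?_, ?_, ?_⟩
  · simp only [ofVolterra]
    rw [hd 1 h1 ⟨le_rfl, h1.le⟩]
    simp [volterraExt, volterraExtDeriv, volterra]
  · simp only [ofVolterra]
    rw [hd _ h3 ⟨h3.le, le_rfl⟩]
    unfold charRemainder at hroot
    simp only [volterraExt, volterraExtDeriv]
    rw [hroot]
    field_simp
    ring
  · simp only [ofVolterra]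
    field_simp
    ring
  · simp only [ofVolterra]
    rw [hd _ h1 h01, hd _ h2 h12]
    field_simp
    ring
  · simp only [ofVolterra]
    field_simp
    ring
  · simp only [ofVolterra]
    rw [hd _ h2 h22, hd _ h3 h23]
    field_simp
    ring

end ofVolterra

end RetardedProblem

/-! ### Normalisation, and eigenvalues as roots of the characteristic equation. -/

theorem volterra_div (q d u : ℝ → ℝ) (μ c x α : ℝ) :
    volterra q d (fun t => u t / α) μ c x = volterra q d u μ c x / α := by
  unfold volterra
  rw [← intervalIntegral.integral_div]
  congr 1
  ext τ
  ring

theorem IsVolterra.div {q d u : ℝ → ℝ} {μ α : ℝ} (hu : IsVolterra q d μ α u) (hα : α ≠ 0) :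
    IsVolterra q d μ 1 (fun t => u t / α) := by
  refine ⟨hu.1.div_const α, fun x hx => ?_⟩
  rw [volterra_div]
  simp only
  rw [hu.2 x hx]
  field_simp

namespace DelayCoeffs

variable {q d : ℝ → ℝ} {Z : Set ℝ} {Q : ℝ}

theorem charRemainder_congr (h : DelayCoeffs q d Z Q) {u v : ℝ → ℝ}
    (huv : EqOn u v (Icc 0 Real.pi)) (μ : ℝ) : charRemainder q d u μ = charRemainder q d v μ := by
  unfold charRemainder
  rw [h.volterra_congr huv, h.volterra_congr huv]

end DelayCoeffs

namespace RetardedProblem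

variable {P : RetardedProblem} {μ Q : ℝ} {U : ThreePieces}

/-- If the value at 0 vanished, the glued function would solve the Volterra equation with α = 0, as
zero does, and uniqueness would make every piece vanish. -/
theorem IsEigenfunction.apply_zero_ne (hP : P.Standing)
    (h : DelayCoeffs P.qExt P.dExt P.jumps Q) (hμ : 0 < μ) (hQμ : 2 * Q * Real.pi ≤ μ)
    (hU : P.IsEigenfunction μ U) : U.y₁ 0 ≠ 0 := by
  intro h0
  have h1 := hP.h₁_pos
  have h2 := hP.h₁_lt_h₂
  have h3 := hP.h₂_lt_pi
  have hw := (isVolterra_glued hP h hμ hU.1).1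
  rw [h0] at hw
  have hz : IsVolterra P.qExt P.dExt μ 0 (fun _ => 0) :=
    ⟨continuous_const, fun x _ => by simp [volterra]⟩
  have heq := h.unique hμ hQμ hw hz
  rcases hU.2 with ⟨x, hx, hne⟩ | ⟨x, hx, hne⟩ | ⟨x, hx, hne⟩
  · have := heq (x := x) ⟨hx.1, by linarith [hx.2]⟩
    rw [glued_first hP ⟨hx.1, hx.2.le⟩] at this
    exact hne this
  · have := heq (x := x) ⟨by linarith [hx.1], by linarith [hx.2]⟩
    rw [glued_second hP hU.1 ⟨hx.1.le, hx.2.le⟩] at this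
    exact (mul_ne_zero hP.δ_ne hne) this
  · have := heq (x := x) ⟨by linarith [hx.1], hx.2⟩
    rw [glued_third hP hU.1 ⟨hx.1.le, hx.2⟩] at this
    exact (mul_ne_zero (mul_ne_zero hP.δ_ne hP.θ_ne) hne) this

theorem IsEigenfunction.root (hP : P.Standing) (h : DelayCoeffs P.qExt P.dExt P.jumps Q)
    (hμ : 0 < μ) (hQμ : 2 * Q * Real.pi ≤ μ) (hU : P.IsEigenfunction μ U) {u : ℝ → ℝ}
    (hu : IsVolterra P.qExt P.dExt μ 1 u) :
    Real.cos (μ * Real.pi) - Real.sin (μ * Real.pi) = charRemainder P.qExt P.dExt u μ := by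
  have hα := hU.apply_zero_ne hP h hμ hQμ
  obtain ⟨hw, hchar⟩ := isVolterra_glued hP h hμ hU.1
  -- By uniqueness `u` is the glued eigenfunction divided by its value at 0, so the boundary
  -- condition transfers to `u`.
  rw [← h.charRemainder_congr (h.unique hμ hQμ (hw.div hα) hu)]
  unfold charRemainder
  rw [volterra_div, volterra_div]
  rw [hw.2 Real.pi ⟨Real.pi_pos.le, le_rfl⟩] at hchar
  field_simp at hchar ⊢
  linear_combination hchar

theorem isEigenfunction_ofVolterra (hP : P.Standing) (h : DelayCoeffs P.qExt P.dExt P.jumps Q)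
    (hμ : 0 < μ) {u : ℝ → ℝ} (hu : IsVolterra P.qExt P.dExt μ 1 u)
    (hroot : Real.cos (μ * Real.pi) - Real.sin (μ * Real.pi) =
      charRemainder P.qExt P.dExt u μ) :
    P.IsEigenfunction μ (P.ofVolterra μ u) ∧ (P.ofVolterra μ u).y₁ 0 = 1 := by
  have h0 : (P.ofVolterra μ u).y₁ 0 = 1 := by
    simp [ofVolterra, volterraExt, volterra]
  refine ⟨⟨isSolution_ofVolterra hP h hμ hu hroot, Or.inl ⟨0, ⟨le_rfl, hP.h₁_pos⟩, ?_⟩⟩, h0⟩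
  rw [h0]
  exact one_ne_zero

end RetardedProblem

end

/-! ### Assembly of the asymptotic formula. -/

theorem theorem5 (P : RetardedProblem) (hP : P.Standing) (ha : P.CondA) (hb : P.CondB) :
    ∃ K : ℝ, ∀ᶠ N : ℕ in atTop,
      (∃! μ : ℝ, P.IsEigenvalue μ ∧ |(N : ℝ) + 1 / 4 - μ| < 1 / 4) ∧
      ∀ μ : ℝ, P.IsEigenvalue μ → |(N : ℝ) + 1 / 4 - μ| < 1 / 4 →
        (∀ U, P.IsEigenfunction μ U → U.y₁ 0 ≠ 0) ∧
        (∃ U, P.IsEigenfunction μ U ∧ U.y₁ 0 = 1) ∧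
        (∀ U, P.IsEigenfunction μ U → U.y₁ 0 = 1 →
          (∀ x ∈ Ico 0 P.h₁,
            |U.y₁ x - P.expansion N x| ≤ K / (N : ℝ) ^ 2) ∧
          (∀ x ∈ Ioo P.h₁ P.h₂,
            |U.y₂ x - 1 / P.δ * P.expansion N x| ≤ K / (N : ℝ) ^ 2) ∧
          (∀ x ∈ Ioc P.h₂ Real.pi,
            |U.y₃ x - 1 / (P.δ * P.θ) * P.expansion N x| ≤ K / (N : ℝ) ^ 2)) := by
  have h1 := hP.h₁_pos
  have h2 := hP.h₁_lt_h₂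
  have h3 := hP.h₂_lt_pi
  have hδ := hP.δ_ne
  have hθ := hP.θ_ne
  obtain ⟨Q, hQ0, hQ⟩ := RetardedProblem.exists_q_bound hP ha
  have h := RetardedProblem.delayCoeffs hP hQ0 hQ
  obtain ⟨J, hJ⟩ := RetardedProblem.exists_oscillates hP ha hb hQ0 hQ
  obtain ⟨L, hL0, hL⟩ := h.exists_charRemainder_lipschitz
  have hM : 0 ≤ 8 * Q * Real.pi + 2 := by have := Real.pi_pos; positivity
  obtain ⟨K, hK⟩ := h.exists_refinedExpansion hJ hM
  -- A solution is selected for every μ, with the zero function below the threshold, so that the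
  -- remainder becomes a function of μ alone.
  have hsol : ∀ μ : ℝ, ∃ u, max 1 (2 * Q * Real.pi) ≤ μ →
      IsVolterra P.qExt P.dExt μ 1 u := fun μ => by
    by_cases hμ : max 1 (2 * Q * Real.pi) ≤ μ
    · obtain ⟨u, hu⟩ := h.exists_solution (one_pos.trans_le ((le_max_left _ _).trans hμ))
        ((le_max_right _ _).trans hμ)
      exact ⟨u, fun _ => hu⟩
    · exact ⟨0, fun h => absurd h hμ⟩
  choose u hu using hsol
  have hroots := eventually_existsUnique_root (R := fun μ => charRemainder P.qExt P.dExt (u μ) μ)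
    (m := max 1 (2 * Q * Real.pi)) hM hL0
    (fun μ hμ => h.abs_charRemainder_le ((le_max_left _ _).trans hμ)
      ((le_max_right _ _).trans hμ) (hu μ hμ))
    (fun μ ν hμ hν => hL μ ν ((le_max_left _ _).trans hμ) ((le_max_left _ _).trans hν)
      ((le_max_right _ _).trans hμ) ((le_max_right _ _).trans hν) _ _ (hu μ hμ) (hu ν hν))
  -- The expansion holds for the glued function with constant `K`; undoing the scaling divides the
  -- error by |δ| or |δθ|.
  refine ⟨max K (max (K / |P.δ|) (K / |P.δ * P.θ|)), ?_⟩
  have hN := tendsto_natCast_atTop_atTop (R := ℝ)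
  filter_upwards [hroots, hN.eventually_ge_atTop (max 1 (2 * Q * Real.pi))] with N hroot hNm
  obtain ⟨hex, hclose⟩ := hroot
  have hN1 : 1 ≤ (N : ℝ) := (le_max_left _ _).trans hNm
  have hNQ : 2 * Q * Real.pi ≤ N := (le_max_right _ _).trans hNm
  have hlarge : ∀ μ : ℝ, |(N : ℝ) + 1 / 4 - μ| < 1 / 4 →
      0 < μ ∧ 2 * Q * Real.pi ≤ μ ∧ max 1 (2 * Q * Real.pi) ≤ μ := fun μ hμ => by
    have := abs_lt.1 hμ
    have hle : (N : ℝ) ≤ μ := by linarith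
    exact ⟨by linarith, hNQ.trans hle, hNm.trans hle⟩
  have hiff : ∀ μ : ℝ, |(N : ℝ) + 1 / 4 - μ| < 1 / 4 → P.IsEigenvalue μ →
      Real.cos (μ * Real.pi) - Real.sin (μ * Real.pi) =
        charRemainder P.qExt P.dExt (u μ) μ := fun μ hμ hev => by
    obtain ⟨-, U, hU⟩ := hev
    obtain ⟨a, b, c⟩ := hlarge μ hμ
    exact hU.root hP h a b (hu μ c)
  have hconv : ∀ μ : ℝ, |(N : ℝ) + 1 / 4 - μ| < 1 / 4 →
      Real.cos (μ * Real.pi) - Real.sin (μ * Real.pi) =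
        charRemainder P.qExt P.dExt (u μ) μ →
      ∃ U, P.IsEigenfunction μ U ∧ U.y₁ 0 = 1 := fun μ hμ hr =>
    ⟨_, RetardedProblem.isEigenfunction_ofVolterra hP h (hlarge μ hμ).1
      (hu μ (hlarge μ hμ).2.2) hr⟩
  refine ⟨?_, fun μ hev hμ => ⟨fun U hU => hU.apply_zero_ne hP h (hlarge μ hμ).1
    (hlarge μ hμ).2.1, hconv μ hμ (hiff μ hμ hev), fun U hU hU0 => ?_⟩⟩
  · obtain ⟨μ, ⟨hμ, hr⟩, huniq⟩ := hex
    obtain ⟨U, hU, -⟩ := hconv μ hμ hr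
    exact ⟨μ, ⟨⟨(hlarge μ hμ).1, U, hU⟩, hμ⟩, fun ν hν => huniq ν ⟨hν.2, hiff ν hν.2 hν.1⟩⟩
  · obtain ⟨hμ0, hμQ, -⟩ := hlarge μ hμ
    -- Any eigenfunction normalised at 0 glues to a Volterra solution with α = 1, so the expansion
    -- applies to it directly.
    have hw := (RetardedProblem.isVolterra_glued hP h hμ0 hU.1).1
    rw [hU0] at hw
    have hexp := hK N μ hN1 hNQ hμ (hclose μ hμ (hiff μ hμ hev)) _ hw (hU.root hP h hμ0 hμQ hw)
    have hN2 : (0 : ℝ) < (N : ℝ) ^ 2 := by positivity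
    have hscale : ∀ {k y e : ℝ}, k ≠ 0 → |k * y - e| ≤ K / (N : ℝ) ^ 2 →
        |y - 1 / k * e| ≤ K / |k| / (N : ℝ) ^ 2 := fun {k y e} hk hle => by
      have hk' : 0 < |k| := abs_pos.2 hk
      have : y - 1 / k * e = (k * y - e) / k := by field_simp
      rw [this, abs_div, div_right_comm]
      exact div_le_div_of_nonneg_right hle hk'.le
    refine ⟨fun x hx => ?_, fun x hx => ?_, fun x hx => ?_⟩
    · have hxπ : x ∈ Icc 0 Real.pi := ⟨hx.1, by linarith [hx.2]⟩
      have := hexp x hxπ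
      rw [← RetardedProblem.expansion_eq hN1 hxπ,
        RetardedProblem.glued_first hP ⟨hx.1, hx.2.le⟩] at this
      exact this.trans (div_le_div_of_nonneg_right (le_max_left _ _) hN2.le)
    · have hxπ : x ∈ Icc 0 Real.pi := ⟨by linarith [hx.1], by linarith [hx.2]⟩
      have := hexp x hxπ
      rw [← RetardedProblem.expansion_eq hN1 hxπ,
        RetardedProblem.glued_second hP hU.1 ⟨hx.1.le, hx.2.le⟩] at this
      exact (hscale hδ this).trans (div_le_div_of_nonneg_right
        ((le_max_left _ _).trans (le_max_right _ _)) hN2.le)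
    · have hxπ : x ∈ Icc 0 Real.pi := ⟨by linarith [hx.1], hx.2⟩
      have := hexp x hxπ
      rw [← RetardedProblem.expansion_eq hN1 hxπ,
        RetardedProblem.glued_third hP hU.1 ⟨hx.1.le, hx.2⟩] at this
      exact (hscale (mul_ne_zero hδ hθ) this).trans (div_le_div_of_nonneg_right
        ((le_max_right _ _).trans (le_max_right _ _)) hN2.le)
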